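/- Fix $n$ qubits arranged on an open line, and let $X_q,Z_q$ be the Pauli operators on qubit $q$. For $\theta\in\mathbb R$ put $R^z_q(\theta)=e^{i\theta Z_q/2}$ $(1\le q\le n)$ and $R^{xx}_{q,q+1}(\theta)=e^{i\theta X_qX_{q+1}/2}$ $(1\le q\le n-1)$. The matchgate group, i.e. the image of $\mathrm{Spin}(2n)$ in $\mathrm{SU}(2^n)$, is the group of $2^n\times 2^n$ unitaries generated by all $R^z_q(\theta)$ and all $R^{xx}_{q,q+1}(\theta)$, $\theta\in\mathbb R$. Let $\overline T_q=R^z_q(\pi/4)$, $\overline S_q=R^z_q(\pi/2)$ and $$\mathcal G=\{\overline T_q,\overline S_q\}_{q=1}^{n}\cup\{R^{xx}_{q,q+1}(\pi/2)\}_{q=1}^{n-1}.$$ Let $U$ be an element of the matchgate group such that all entries of $U\otimes U^*$ (where $U^*$ is the entrywise complex conjugate of $U$, in the computational basis) lie in the ring $\mathbb Z[1/\sqrt2,\,i]$. Then $U$ can be synthesized exactly, without ancillas, over $\mathcal G$: there are finitely many gates $g_1,\dots,g_\ell\in\mathcal G$, acting on the same $n$ qubits, with $U=g_1g_2\cdots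 g_\ell$. -/

import Mathlib

noncomputable section

namespace Matchgate

/-- Operators on `n` qubits, as matrices in the computational basis, whose elements are the
bit strings `Fin n → Fin 2`. -/
abbrev QOp (n : ℕ) : Type := Matrix (Fin n → Fin 2) (Fin n → Fin 2) ℂ

/-- The Pauli matrix `X`. -/
def pauliX : Matrix (Fin 2) (Fin 2) ℂ := !![0, 1; 1, 0]

/-- The Pauli matrix `Z`. -/
def pauliZ : Matrix (Fin 2) (Fin 2) ℂ := !![1, 0; 0, -1]

/-- The tensor product `P 0 ⊗ P 1 ⊗ ⋯ ⊗ P (n - 1)` of single-qubit operators. -/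
def tensor {n : ℕ} (P : Fin n → Matrix (Fin 2) (Fin 2) ℂ) : QOp n :=
  Matrix.of fun x y => ∏ r, P r (x r) (y r)

/-- The single-qubit operator `A` acting on qubit `q`, and the identity on every other qubit. -/
def onQubit {n : ℕ} (q : Fin n) (A : Matrix (Fin 2) (Fin 2) ℂ) : QOp n :=
  tensor (Function.update (fun _ => (1 : Matrix (Fin 2) (Fin 2) ℂ)) q A)

theorem tensor_isHermitian {n : ℕ} (P : Fin n → Matrix (Fin 2) (Fin 2) ℂ)
    (hP : ∀ r, (P r).IsHermitian) : (tensor P).IsHermitian := by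
  ext x y
  simp only [tensor, Matrix.conjTranspose_apply, Matrix.of_apply, star_prod]
  exact Finset.prod_congr rfl fun r _ => (hP r).apply _ _

theorem onQubit_isHermitian {n : ℕ} (q : Fin n) (A : Matrix (Fin 2) (Fin 2) ℂ)
    (hA : A.IsHermitian) : (onQubit q A).IsHermitian := by
  refine tensor_isHermitian _ fun r => ?_
  by_cases h : r = q
  · subst h; simpa using hA
  · simp [Function.update_of_ne h]

theorem pauliX_isHermitian : pauliX.IsHermitian := by
  ext i j; fin_cases i <;> fin_cases j <;> simp [pauliX]

theorem pauliZ_isHermitian : pauliZ.IsHermitian := by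
  ext i j; fin_cases i <;> fin_cases j <;> simp [pauliZ]

/-- The generator `X_p X_q`, written as the tensor product with `X` on the qubits `p` and `q`. -/
def opXX {n : ℕ} (p q : Fin n) : QOp n :=
  tensor fun r => if r = p ∨ r = q then pauliX else 1

theorem opXX_isHermitian {n : ℕ} (p q : Fin n) : (opXX p q).IsHermitian := by
  refine tensor_isHermitian _ fun r => ?_
  split_ifs
  · exact pauliX_isHermitian
  · exact Matrix.isHermitian_one

/-- `exp(iθH/2)` is unitary for Hermitian `H`. -/
theorem exp_mem_unitaryGroup {n : ℕ} (H : QOp n) (hH : H.IsHermitian) (θ : ℝ) :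
    NormedSpace.exp ((Complex.I * (θ : ℂ) / 2) • H) ∈
      Matrix.unitaryGroup (Fin n → Fin 2) ℂ := by
  rw [Matrix.mem_unitaryGroup_iff', Matrix.star_eq_conjTranspose, ← Matrix.exp_conjTranspose]
  have h : ((Complex.I * (θ : ℂ) / 2) • H).conjTranspose = -((Complex.I * (θ : ℂ) / 2) • H) := by
    rw [Matrix.conjTranspose_smul, hH.eq, ← neg_smul]
    congr 1
    simp [neg_div]
  rw [h, ← Matrix.exp_add_of_commute _ _
    (Commute.refl ((Complex.I * (θ : ℂ) / 2) • H)).neg_left, neg_add_cancel, NormedSpace.exp_zero]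

/-- The rotation `R^z_q(θ) = exp(iθ Z_q / 2)`. -/
def Rz {n : ℕ} (q : Fin n) (θ : ℝ) : Matrix.unitaryGroup (Fin n → Fin 2) ℂ :=
  ⟨NormedSpace.exp ((Complex.I * (θ : ℂ) / 2) • onQubit q pauliZ),
    exp_mem_unitaryGroup _ (onQubit_isHermitian q _ pauliZ_isHermitian) θ⟩

/-- The rotation `R^{xx}_{p,q}(θ) = exp(iθ X_p X_q / 2)`. -/
def Rxx {n : ℕ} (p q : Fin n) (θ : ℝ) : Matrix.unitaryGroup (Fin n → Fin 2) ℂ :=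
  ⟨NormedSpace.exp ((Complex.I * (θ : ℂ) / 2) • opXX p q),
    exp_mem_unitaryGroup _ (opXX_isHermitian p q) θ⟩

/-- The matchgate group on `n` qubits in an open one-dimensional array: the group of unitaries
generated by all rotations `R^z_q(θ)` and all nearest-neighbour rotations `R^{xx}_{q,q+1}(θ)`. It
is the image of `Spin(2n)` in its spin representation. -/
def matchgateGroup (n : ℕ) : Subgroup (Matrix.unitaryGroup (Fin n → Fin 2) ℂ) :=
  Subgroup.closure
    ({U | ∃ (q : Fin n) (θ : ℝ), U = Rz q θ} ∪
      {U | ∃ (p q : Fin n) (θ : ℝ), p.val + 1 = q.val ∧ U = Rxx p q θ})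

/-- The gate `T̄_q = R^z_q(π/4)`. -/
def Tbar {n : ℕ} (q : Fin n) : Matrix.unitaryGroup (Fin n → Fin 2) ℂ := Rz q (Real.pi / 4)

/-- The gate `S̄_q = R^z_q(π/2)`. -/
def Sbar {n : ℕ} (q : Fin n) : Matrix.unitaryGroup (Fin n → Fin 2) ℂ := Rz q (Real.pi / 2)

/-- The finite gate set consisting of all `T̄_q`, all `S̄_q` and all `R^{xx}_{q,q+1}(π/2)`. -/
def gateSet (n : ℕ) : Set (Matrix.unitaryGroup (Fin n → Fin 2) ℂ) :=
  {g | ∃ q : Fin n, g = Tbar q} ∪ {g | ∃ q : Fin n, g = Sbar q} ∪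
    {g | ∃ p q : Fin n, p.val + 1 = q.val ∧ g = Rxx p q (Real.pi / 2)}

/-- The subring `ℤ[1/√2, i]` of `ℂ`. -/
def ringZ : Subring ℂ := Subring.closure {((1 / Real.sqrt 2 : ℝ) : ℂ), Complex.I}

end Matchgate

end

noncomputable section

/-! ### Pauli tensors, Jordan–Wigner Majorana operators, parity and the invariant form. -/

namespace Matchgate

variable {n : ℕ}

/-! Under Jordan–Wigner the generators become rotors `cos (θ/2) + sin (θ/2) γ_a γ_b` in the 2n
Majorana operators, for planes that link all 2n of them into a path. Conjugation by `U` is therefore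
orthogonal on the real span of the Majoranas (`rotor_mul_combo`). Its matrix entries `2⁻ⁿ tr (γ_a U
γ_b U†)` are linear in the entries of `U ⊗ U*`, so they are real elements of the ring
(`coeff_mem_ringZ`).

This matrix is reduced column by column. Rotors through π/2 carry one coordinate plane to another,
so a π/4 rotation in every plane is available (`rotorSynth_pi_div_four`). Write a unit column as `(α
+ β√2) / √2 ^ k`. Rotating two entries with odd `α` and equal parity of `β` makes both `α` even;
once all `α` are even, `k` drops; at `k = 0` only a signed basis vector is left
(`reduce_unit_vector`).

Two ambiguities remain. The last column could be `-e_j`, but matchgates commute with fermion parity,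
which excludes determinant -1 (`not_single_sign_flip`). An element acting trivially is a scalar, and
an invariant bilinear form forces it to be ±1 (`eq_one_or_neg_one_of_scalar`); -1 is the eighth
power of a `Tbar` gate. Inverses are not needed because the gates have finite order. -/

theorem tensor_mul (P Q : Fin n → Matrix (Fin 2) (Fin 2) ℂ) :
    tensor P * tensor Q = tensor fun r => P r * Q r := by
  ext x y
  simp only [tensor, Matrix.mul_apply, Matrix.of_apply, ← Finset.prod_mul_distrib]
  exact (Fintype.prod_sum fun r k => P r (x r) k * Q r k (y r)).symm

theorem tensor_one : tensor (fun _ : Fin n => (1 : Matrix (Fin 2) (Fin 2) ℂ)) = 1 := by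
  ext x y
  simp only [tensor, Matrix.of_apply, Matrix.one_apply]
  by_cases h : x = y
  · simp [h]
  · obtain ⟨r, hr⟩ := Function.ne_iff.mp h
    rw [if_neg h]
    exact Finset.prod_eq_zero (Finset.mem_univ r) (if_neg hr)

theorem tensor_smul (c : Fin n → ℂ) (P : Fin n → Matrix (Fin 2) (Fin 2) ℂ) :
    (tensor fun r => c r • P r) = (∏ r, c r) • tensor P := by
  ext x y
  simp [tensor, Finset.prod_mul_distrib]

theorem tensor_transpose (P : Fin n → Matrix (Fin 2) (Fin 2) ℂ) :
    (tensor P).transpose = tensor fun r => (P r).transpose := rfl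

theorem tensor_eq_smul {P Q : Fin n → Matrix (Fin 2) (Fin 2) ℂ} (c : Fin n → ℂ)
    (h : ∀ r, P r = c r • Q r) : tensor P = (∏ r, c r) • tensor Q := by
  rw [← tensor_smul]
  exact congrArg tensor (funext h)

theorem prod_ite_neg_one (q : Fin n) : (∏ r, if r = q then (-1 : ℂ) else 1) = -1 := by
  simp

/-- The Pauli matrix `Y`. -/
def pauliY : Matrix (Fin 2) (Fin 2) ℂ := !![0, -Complex.I; Complex.I, 0]

theorem pauliX_mul_self : pauliX * pauliX = 1 := by
  ext i j; fin_cases i <;> fin_cases j <;> simp [pauliX]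

theorem pauliY_mul_self : pauliY * pauliY = 1 := by
  ext i j; fin_cases i <;> fin_cases j <;> simp [pauliY]

theorem pauliZ_mul_self : pauliZ * pauliZ = 1 := by
  ext i j; fin_cases i <;> fin_cases j <;> simp [pauliZ]

theorem pauliX_mul_pauliY : pauliX * pauliY = Complex.I • pauliZ := by
  ext i j; fin_cases i <;> fin_cases j <;> simp [pauliX, pauliY, pauliZ]

theorem pauliY_mul_pauliX : pauliY * pauliX = -(Complex.I • pauliZ) := by
  ext i j; fin_cases i <;> fin_cases j <;> simp [pauliX, pauliY, pauliZ]

theorem pauliZ_mul_pauliX : pauliZ * pauliX = -(pauliX * pauliZ) := by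
  ext i j; fin_cases i <;> fin_cases j <;> simp [pauliX, pauliZ]

theorem pauliZ_mul_pauliY : pauliZ * pauliY = -(pauliY * pauliZ) := by
  ext i j; fin_cases i <;> fin_cases j <;> simp [pauliY, pauliZ]

theorem pauliY_mul_pauliZ : pauliY * pauliZ = Complex.I • pauliX := by
  ext i j; fin_cases i <;> fin_cases j <;> simp [pauliX, pauliY, pauliZ]

theorem pauliX_transpose : pauliX.transpose = pauliX := by
  ext i j; fin_cases i <;> fin_cases j <;> simp [pauliX]

theorem pauliZ_transpose : pauliZ.transpose = pauliZ := by
  ext i j; fin_cases i <;> fin_cases j <;> simp [pauliZ]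

/-- The local factor of a Majorana operator: `X` for index `0` and `Y` for index `1`. -/
def pauliXY (e : Fin 2) : Matrix (Fin 2) (Fin 2) ℂ := if e = 0 then pauliX else pauliY

theorem pauliXY_mul_self (e : Fin 2) : pauliXY e * pauliXY e = 1 := by
  unfold pauliXY; split_ifs
  · exact pauliX_mul_self
  · exact pauliY_mul_self

theorem pauliZ_mul_pauliXY (e : Fin 2) : pauliZ * pauliXY e = -(pauliXY e * pauliZ) := by
  unfold pauliXY; split_ifs
  · exact pauliZ_mul_pauliX
  · exact pauliZ_mul_pauliY

theorem pauliXY_mul_of_ne {e f : Fin 2} (h : e ≠ f) :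
    pauliXY e * pauliXY f = -(pauliXY f * pauliXY e) := by
  fin_cases e <;> fin_cases f <;>
    simp_all [pauliXY, pauliX_mul_pauliY, pauliY_mul_pauliX]

/-- The local factors of a Jordan–Wigner Majorana operator. -/
def majoranaFactor (a : Fin n × Fin 2) (r : Fin n) : Matrix (Fin 2) (Fin 2) ℂ :=
  if r < a.1 then pauliZ else if r = a.1 then pauliXY a.2 else 1

/-- The Jordan–Wigner Majorana operators `Z ⋯ Z X_q` and `Z ⋯ Z Y_q`. -/
def majorana (a : Fin n × Fin 2) : QOp n := tensor (majoranaFactor a)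

theorem majorana_mul_self (a : Fin n × Fin 2) : majorana a * majorana a = 1 := by
  rw [majorana, tensor_mul, ← tensor_one]
  congr 1; funext r
  unfold majoranaFactor
  split_ifs
  · exact pauliZ_mul_self
  · exact pauliXY_mul_self _
  · simp

theorem tensor_anticommute {P Q : Fin n → Matrix (Fin 2) (Fin 2) ℂ} (q : Fin n)
    (hq : P q * Q q = -(Q q * P q)) (h : ∀ r, r ≠ q → P r * Q r = Q r * P r) :
    tensor P * tensor Q = -(tensor Q * tensor P) := by
  rw [tensor_mul, tensor_mul, tensor_eq_smul (fun r => if r = q then (-1 : ℂ) else 1)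
    (Q := fun r => Q r * P r), prod_ite_neg_one, neg_one_smul]
  intro r
  by_cases hr : r = q
  · subst hr; simp [hq]
  · simp [hr, h r hr]

theorem majorana_anticommute_of_lt {a b : Fin n × Fin 2} (h : a.1 < b.1) :
    majorana a * majorana b = -(majorana b * majorana a) := by
  refine tensor_anticommute a.1 ?_ ?_
  · simp [majoranaFactor, h, pauliZ_mul_pauliXY]
  · intro r hr
    unfold majoranaFactor
    by_cases h1 : r < a.1
    · simp [h1, h1.trans h]
    · simp [h1, hr]

theorem majorana_anticommute {a b : Fin n × Fin 2} (h : a ≠ b) :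
    majorana a * majorana b = -(majorana b * majorana a) := by
  rcases lt_trichotomy a.1 b.1 with h1 | h1 | h1
  · exact majorana_anticommute_of_lt h1
  · have h2 : a.2 ≠ b.2 := fun h2 => h (Prod.ext h1 h2)
    refine tensor_anticommute a.1 ?_ ?_
    · simp [majoranaFactor, ← h1, pauliXY_mul_of_ne h2]
    · intro r hr
      unfold majoranaFactor
      rw [← h1]
      simp [hr]
  · rw [majorana_anticommute_of_lt h1, neg_neg]

theorem majorana_mul_majorana_same (q : Fin n) :
    majorana (q, 0) * majorana (q, 1) = Complex.I • onQubit q pauliZ := by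
  rw [majorana, majorana, tensor_mul, onQubit,
    tensor_eq_smul (fun r => if r = q then Complex.I else 1)]
  · simp; rfl
  · intro r
    rcases lt_trichotomy r q with h | h | h
    · simp [majoranaFactor, h, h.ne, pauliZ_mul_self]
    · simp [majoranaFactor, h, pauliXY, pauliX_mul_pauliY]
    · simp [majoranaFactor, h.ne', h.not_gt]

theorem majorana_mul_majorana_succ {p q : Fin n} (h : p.val + 1 = q.val) :
    majorana (p, 1) * majorana (q, 0) = Complex.I • opXX p q := by
  have hpq : p < q := by rw [Fin.lt_def]; omega
  rw [majorana, majorana, tensor_mul, opXX,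
    tensor_eq_smul (fun r => if r = p then Complex.I else 1)]
  · simp; rfl
  · intro r
    rcases lt_trichotomy r p with h1 | h1 | h1
    · simp [majoranaFactor, h1, h1.ne, (h1.trans hpq).ne, h1.trans hpq, pauliZ_mul_self]
    · simp [majoranaFactor, h1, pauliXY, hpq, pauliY_mul_pauliZ]
    · have h2 : ¬ r < q := by rw [Fin.lt_def] at *; omega
      by_cases h3 : r = q
      · simp [majoranaFactor, h3, hpq.ne', hpq.not_gt, pauliXY]
      · simp [majoranaFactor, h1.not_gt, h1.ne', h2, h3]

/-- The fermion parity operator `Z ⊗ ⋯ ⊗ Z`. -/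
def parity (n : ℕ) : QOp n := tensor fun _ => pauliZ

theorem parity_mul_self : parity n * parity n = 1 := by
  rw [parity, tensor_mul, ← tensor_one]
  simp only [pauliZ_mul_self]

theorem parity_mul_majorana (a : Fin n × Fin 2) :
    parity n * majorana a = -(majorana a * parity n) := by
  refine tensor_anticommute a.1 ?_ ?_
  · simp [majoranaFactor, pauliZ_mul_pauliXY]
  · intro r hr
    unfold majoranaFactor
    split_ifs <;> simp

/-- The bilinear form preserved by the matchgate group: alternating factors `X` and `XZ`. -/
def spinForm (n : ℕ) : QOp n :=
  tensor fun r => if Even r.val then pauliX else pauliX * pauliZ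

/-- Infinitesimal invariance of the form. Both `X` and `XZ` anticommute with `Z`, so site `q`
supplies the one sign. -/
theorem onQubit_mul_spinForm (q : Fin n) :
    onQubit q pauliZ * spinForm n = -(spinForm n * (onQubit q pauliZ).transpose) := by
  have h : (onQubit q pauliZ).transpose = onQubit q pauliZ := by
    rw [onQubit, tensor_transpose]
    congr 1; funext r
    by_cases h : r = q
    · subst h; simp [pauliZ_transpose]
    · simp [h]
  rw [h]
  refine tensor_anticommute q ?_ ?_
  · split_ifs
    · simp [pauliZ_mul_pauliX]
    · simp only [Function.update_self]
      rw [← mul_assoc, pauliZ_mul_pauliX, neg_mul]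
  · intro r hr
    simp [hr]

/-- This is why the factors alternate: `X` commutes with `X` and anticommutes with `XZ`, so exactly
one of two neighbouring sites supplies a sign. -/
theorem opXX_mul_spinForm {p q : Fin n} (h : p.val + 1 = q.val) :
    opXX p q * spinForm n = -(spinForm n * (opXX p q).transpose) := by
  have hpq : p ≠ q := by rintro rfl; omega
  have ht : (opXX p q).transpose = opXX p q := by
    rw [opXX, tensor_transpose]
    congr 1; funext r
    split_ifs
    · exact pauliX_transpose
    · simp
  rw [ht]
  have hX : pauliX * (pauliX * pauliZ) = -(pauliX * pauliZ * pauliX) := by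
    rw [mul_assoc, pauliZ_mul_pauliX, mul_neg, neg_neg]
  rcases Nat.even_or_odd p.val with hp | hp
  · have hq : ¬ Even q.val := by rw [← h, Nat.not_even_iff_odd]; exact hp.add_one
    refine tensor_anticommute q (by simp [hq, hX]) fun r hr => ?_
    by_cases hrp : r = p
    · subst hrp; simp [hp]
    · simp [hr, hrp]
  · have hq : Even q.val := by rw [← h]; exact hp.add_one
    refine tensor_anticommute p (by simp [Nat.not_even_iff_odd.mpr hp, hX]) fun r hr => ?_
    by_cases hrq : r = q
    · subst hrq; simp [hq]
    · simp [hr, hrq]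

theorem exists_spinForm_mul_eq_one : ∃ B : QOp n, spinForm n * B = 1 := by
  refine ⟨tensor fun r => if Even r.val then pauliX else pauliZ * pauliX, ?_⟩
  rw [spinForm, tensor_mul, ← tensor_one]
  congr 1; funext r
  split_ifs
  · exact pauliX_mul_self
  · rw [mul_assoc, ← mul_assoc pauliZ, pauliZ_mul_self, one_mul, pauliX_mul_self]

/-! ### Commutant of the Majorana operators, and trace orthogonality. -/

theorem eq_of_forall_update_eq {α : Type*} (d : (Fin n → Fin 2) → α)
    (h : ∀ x q e, d (Function.update x q e) = d x) (x y : Fin n → Fin 2) : d x = d y := by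
  have key : ∀ s : Finset (Fin n), d (s.piecewise x y) = d y := by
    intro s
    induction s using Finset.induction_on with
    | empty => simp
    | insert q s hq ih => rw [Finset.piecewise_insert, h, ih]
  simpa using key Finset.univ

theorem majorana_apply_ne_zero (x : Fin n → Fin 2) (q : Fin n) :
    majorana (q, 0) (Function.update x q (1 - x q)) x ≠ 0 := by
  simp only [majorana, tensor, Matrix.of_apply]
  refine Finset.prod_ne_zero_iff.mpr fun r _ => ?_
  unfold majoranaFactor
  rcases lt_trichotomy r q with h | h | h
  · have : x r = 0 ∨ x r = 1 := by omega
    rcases this with h1 | h1 <;> simp [h, h.ne, h1, pauliZ]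
  · subst h
    have : x r = 0 ∨ x r = 1 := by omega
    rcases this with h1 | h1 <;> simp [h1, pauliXY, pauliX]
  · simp [h.not_gt, h.ne', Matrix.one_apply]

theorem onQubit_pauliZ_eq_diagonal (q : Fin n) :
    onQubit q pauliZ = Matrix.diagonal fun x => if x q = 0 then (1 : ℂ) else -1 := by
  ext x y
  rw [Matrix.diagonal_apply]
  simp only [onQubit, tensor, Matrix.of_apply]
  by_cases h : x = y
  · subst h
    rw [if_pos rfl, Finset.prod_eq_single q]
    · have : x q = 0 ∨ x q = 1 := by omega
      rcases this with h1 | h1 <;> simp [h1, pauliZ]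
    · intro r _ hr; simp [hr]
    · simp
  · obtain ⟨r, hr⟩ := Function.ne_iff.mp h
    rw [if_neg h]
    refine Finset.prod_eq_zero (Finset.mem_univ r) ?_
    by_cases hq : r = q
    · subst hq
      have : x r = 0 ∨ x r = 1 := by omega
      have : y r = 0 ∨ y r = 1 := by omega
      rcases ‹x r = 0 ∨ x r = 1› with h1 | h1 <;> rcases this with h2 | h2 <;>
        simp_all [pauliZ]
    · simp [hq, hr]

/-- An operator commuting with all Majorana operators is a scalar. -/
theorem exists_smul_one_of_commute_majorana (M : QOp n)
    (h : ∀ a, M * majorana a = majorana a * M) : ∃ c : ℂ, M = c • 1 := by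
  -- Each `Z_q` is a multiple of a product of two Majoranas. Commuting with all of them makes `M`
  -- diagonal, since two distinct bit strings are separated by some `Z_q`.
  have hZ : ∀ q, M * onQubit q pauliZ = onQubit q pauliZ * M := by
    intro q
    have h1 : M * (majorana (q, 0) * majorana (q, 1)) =
        majorana (q, 0) * majorana (q, 1) * M := by
      rw [← mul_assoc, h, mul_assoc, h, mul_assoc]
    rw [majorana_mul_majorana_same, mul_smul_comm, smul_mul_assoc] at h1
    exact smul_right_injective _ Complex.I_ne_zero h1
  have hoff : ∀ x y, x ≠ y → M x y = 0 := by
    intro x y hxy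
    obtain ⟨q, hq⟩ := Function.ne_iff.mp hxy
    have h1 := congrFun (congrFun (hZ q) x) y
    rw [onQubit_pauliZ_eq_diagonal, Matrix.mul_diagonal, Matrix.diagonal_mul] at h1
    have : x q = 0 ∨ x q = 1 := by omega
    have h3 : y q = 0 ∨ y q = 1 := by omega
    rcases this with h2 | h2 <;> rcases h3 with h3 | h3 <;> simp [h2, h3] at h1 hq <;> grind
  have hdiag : M = Matrix.diagonal fun x => M x x := by
    ext x y
    rw [Matrix.diagonal_apply]
    split_ifs with hxy
    · rw [hxy]
    · exact hoff x y hxy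
  -- `γ_(q,0)` has a nonzero entry between `x` and its flip at `q`, so commuting with it equates the
  -- two diagonal entries.
  have hconst : ∀ x q e, M (Function.update x q e) (Function.update x q e) = M x x := by
    intro x q e
    have he : e = x q ∨ e = 1 - x q := by omega
    rcases he with he | he
    · simp [he]
    · subst he
      have h1 := congrFun (congrFun (h (q, 0)) (Function.update x q (1 - x q))) x
      rw [hdiag, Matrix.diagonal_mul, Matrix.mul_diagonal, mul_comm] at h1
      exact mul_left_cancel₀ (majorana_apply_ne_zero x q) h1
  refine ⟨M 0 0, ?_⟩
  ext x y
  rw [Matrix.smul_apply, Matrix.one_apply]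
  split_ifs with hxy
  · subst hxy
    simpa using eq_of_forall_update_eq (fun x => M x x) hconst x 0
  · simpa using hoff x y hxy

theorem majorana_mem_ringZ (a : Fin n × Fin 2) (x y : Fin n → Fin 2) :
    majorana a x y ∈ ringZ := by
  have hI : Complex.I ∈ ringZ := Subring.subset_closure (by simp)
  simp only [majorana, tensor, Matrix.of_apply]
  refine Subring.prod_mem _ fun r _ => ?_
  generalize x r = i
  generalize y r = j
  unfold majoranaFactor pauliXY
  split_ifs <;> fin_cases i <;> fin_cases j <;>
    simp [pauliX, pauliY, pauliZ, hI, one_mem, zero_mem]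

theorem trace_majorana_mul (a b : Fin n × Fin 2) :
    (majorana a * majorana b).trace = if a = b then (2 : ℂ) ^ n else 0 := by
  split_ifs with h
  · subst h
    simp [majorana_mul_self, Matrix.trace_one]
  · have h1 := congrArg Matrix.trace (majorana_anticommute h)
    rw [Matrix.trace_neg, Matrix.trace_mul_comm (majorana b)] at h1
    exact self_eq_neg.mp h1

end Matchgate

/-! ### Rotors in a Clifford algebra and their action on vectors. -/

namespace Matchgate

/-- The plane rotation `(v a, v b) ↦ (c v a + s v b, c v b - s v a)` of coefficient vectors. -/
def planeRot {ι : Type*} [DecidableEq ι] (a b : ι) (c s : ℝ) (v : ι → ℝ) : ι → ℝ := fun x =>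
  if x = a then c * v a + s * v b else if x = b then c * v b - s * v a else v x

/-- The real linear combination `∑ x, v x • γ x`. -/
def combo {ι A : Type*} [Fintype ι] [Ring A] [Algebra ℝ A] (γ : ι → A) (v : ι → ℝ) : A :=
  ∑ x, v x • γ x

/-- The rotor `cos (θ / 2) + sin (θ / 2) γ_a γ_b`. -/
def rotor {ι A : Type*} [Ring A] [Algebra ℝ A] (γ : ι → A) (a b : ι) (θ : ℝ) : A :=
  Real.cos (θ / 2) • (1 : A) + Real.sin (θ / 2) • (γ a * γ b)

section Clifford

variable {ι A : Type*} [Ring A] {γ : ι → A}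

theorem mul_mul_mul_self_of_anticommute (hsq : ∀ a, γ a * γ a = 1)
    (hac : ∀ a b, a ≠ b → γ a * γ b = -(γ b * γ a)) {a b : ι} (h : a ≠ b) :
    γ a * γ b * γ a = -γ b := by
  rw [hac a b h, neg_mul, mul_assoc, hsq, mul_one]

theorem mul_mul_mul_pair_self (hsq : ∀ a, γ a * γ a = 1)
    (hac : ∀ a b, a ≠ b → γ a * γ b = -(γ b * γ a)) {a b : ι} (h : a ≠ b) :
    γ a * γ b * (γ a * γ b) = -1 := by
  rw [← mul_assoc, mul_mul_mul_self_of_anticommute hsq hac h, neg_mul, hsq]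

variable [Algebra ℝ A]

theorem rotor_zero (a b : ι) : rotor γ a b 0 = 1 := by simp [rotor]

theorem rotor_two_pi (a b : ι) : rotor γ a b (2 * Real.pi) = -1 := by simp [rotor]

theorem rotor_four_pi (a b : ι) : rotor γ a b (4 * Real.pi) = 1 := by
  have : 4 * Real.pi / 2 = 2 * Real.pi := by ring
  simp [rotor, this]

theorem rotor_mul_rotor (hsq : ∀ a, γ a * γ a = 1)
    (hac : ∀ a b, a ≠ b → γ a * γ b = -(γ b * γ a)) {a b : ι} (h : a ≠ b) (θ φ : ℝ) :
    rotor γ a b θ * rotor γ a b φ = rotor γ a b (θ + φ) := by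
  simp only [rotor, add_div, Real.cos_add, Real.sin_add, mul_add, add_mul, smul_mul_smul_comm,
    mul_mul_mul_pair_self hsq hac h, one_mul, mul_one]
  module

theorem rotor_pow (hsq : ∀ a, γ a * γ a = 1)
    (hac : ∀ a b, a ≠ b → γ a * γ b = -(γ b * γ a)) {a b : ι} (h : a ≠ b) (θ : ℝ) (k : ℕ) :
    rotor γ a b θ ^ k = rotor γ a b (k * θ) := by
  induction k with
  | zero => simp [rotor_zero]
  | succ k ih =>
    rw [pow_succ, ih, rotor_mul_rotor hsq hac h]
    congr 1; push_cast; ring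

theorem rotor_swap (hac : ∀ a b, a ≠ b → γ a * γ b = -(γ b * γ a)) {a b : ι} (h : a ≠ b)
    (θ : ℝ) : rotor γ b a θ = rotor γ a b (-θ) := by
  simp [rotor, neg_div, hac b a h.symm]

/-- The π/2 rotor `R` in the plane `b`, `c` satisfies `R⁻¹ γ_b R = γ_c`, so conjugating by it moves
a rotor from the plane `a`, `b` to `a`, `c` at the same angle. -/
theorem rotor_mul_rotor_pi_div_two (hsq : ∀ a, γ a * γ a = 1)
    (hac : ∀ a b, a ≠ b → γ a * γ b = -(γ b * γ a)) {a b c : ι} (hab : a ≠ b)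
    (hca : a ≠ c) (θ : ℝ) :
    rotor γ a b θ * rotor γ b c (Real.pi / 2) = rotor γ b c (Real.pi / 2) * rotor γ a c θ := by
  have e1 : Real.pi / 2 / 2 = Real.pi / 4 := by ring
  have h1 : γ a * γ b * (γ b * γ c) = γ a * γ c := by
    rw [mul_assoc, ← mul_assoc (γ b), hsq, one_mul]
  have h2 : γ b * γ c * (γ a * γ c) = γ a * γ b := by
    rw [mul_assoc, ← mul_assoc (γ c), mul_mul_mul_self_of_anticommute hsq hac hca.symm, mul_neg,
      hac a b hab]
  simp only [rotor, e1, Real.cos_pi_div_four, Real.sin_pi_div_four, mul_add, add_mul,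
    smul_mul_smul_comm, one_mul, mul_one, h1, h2]
  module

theorem rotor_mul_of_ne (hac : ∀ a b, a ≠ b → γ a * γ b = -(γ b * γ a)) {a b x : ι}
    (ha : x ≠ a) (hb : x ≠ b) (θ : ℝ) : rotor γ a b θ * γ x = γ x * rotor γ a b θ := by
  have h1 : γ a * γ b * γ x = γ x * (γ a * γ b) := by
    rw [mul_assoc, hac b x hb.symm, mul_neg, ← mul_assoc, hac a x ha.symm, neg_mul, neg_neg,
      mul_assoc]
  simp only [rotor, mul_add, add_mul, smul_mul_assoc, mul_smul_comm, h1, one_mul, mul_one]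

variable [Fintype ι] [DecidableEq ι]

theorem combo_single (j : ι) : combo γ (Pi.single j 1) = γ j := by
  unfold combo
  rw [Finset.sum_eq_single j] <;> simp +contextual

theorem mul_combo_add_combo_mul (hsq : ∀ a, γ a * γ a = 1)
    (hac : ∀ a b, a ≠ b → γ a * γ b = -(γ b * γ a)) (b : ι) (v : ι → ℝ) :
    γ b * combo γ v + combo γ v * γ b = (2 * v b) • (1 : A) := by
  have : ∀ x, γ b * (v x • γ x) + v x • γ x * γ b = if x = b then (2 * v b) • (1 : A) else 0 := by
    intro x
    rw [mul_smul_comm, smul_mul_assoc]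
    split_ifs with h
    · subst h; rw [hsq]; module
    · rw [hac x b h]; module
  simp only [combo, Finset.mul_sum, Finset.sum_mul, ← Finset.sum_add_distrib, this]
  simp

theorem combo_mul_self (hsq : ∀ a, γ a * γ a = 1)
    (hac : ∀ a b, a ≠ b → γ a * γ b = -(γ b * γ a)) (v : ι → ℝ) :
    combo γ v * combo γ v = (∑ x, v x ^ 2) • (1 : A) := by
  -- Doubling writes the square as a sum of anticommutators `γ_x w + w γ_x`, each of which is a
  -- scalar.
  have h : (2 : ℝ) • (combo γ v * combo γ v) = (2 : ℝ) • ((∑ x, v x ^ 2) • (1 : A)) := by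
    have h1 : ∀ x, v x • (γ x * combo γ v + combo γ v * γ x) =
        v x • γ x * combo γ v + combo γ v * (v x • γ x) := fun x => by
      rw [smul_add, smul_mul_assoc, mul_smul_comm]
    calc (2 : ℝ) • (combo γ v * combo γ v)
        = ∑ x, v x • (γ x * combo γ v + combo γ v * γ x) := by
          simp only [h1]
          rw [Finset.sum_add_distrib, ← Finset.sum_mul, ← Finset.mul_sum, two_smul]
          rfl
      _ = _ := by
          simp only [mul_combo_add_combo_mul hsq hac, Finset.sum_smul, Finset.smul_sum, smul_smul]
          exact Finset.sum_congr rfl fun x _ => by congr 1; ring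
  exact smul_right_injective _ (two_ne_zero' ℝ) h

theorem combo_planeRot {a b : ι} (h : a ≠ b) (c s : ℝ) (v : ι → ℝ) :
    combo γ (planeRot a b c s v) = combo γ v + (c * v a + s * v b - v a) • γ a +
      (c * v b - s * v a - v b) • γ b := by
  have : ∀ x, planeRot a b c s v x • γ x = v x • γ x +
      (if x = a then (c * v a + s * v b - v a) • γ a else 0) +
      (if x = b then (c * v b - s * v a - v b) • γ b else 0) := by
    intro x
    unfold planeRot
    by_cases h1 : x = a
    · subst h1; simp only [if_true, h, if_false]; module
    · by_cases h2 : x = b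
      · subst h2; simp only [h1, if_true, if_false]; module
      · simp [h1, h2]
  simp [combo, this, Finset.sum_add_distrib]

theorem pair_mul_combo (hsq : ∀ a, γ a * γ a = 1)
    (hac : ∀ a b, a ≠ b → γ a * γ b = -(γ b * γ a)) {a b : ι} (h : a ≠ b) (v : ι → ℝ) :
    γ a * γ b * combo γ v =
      combo γ v * (γ a * γ b) + (2 * v b) • γ a - (2 * v a) • γ b := by
  have : ∀ x, γ a * γ b * (v x • γ x) = v x • γ x * (γ a * γ b) +
      (if x = b then (2 * v b) • γ a else 0) - (if x = a then (2 * v a) • γ b else 0) := by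
    intro x
    rw [mul_smul_comm, smul_mul_assoc]
    by_cases h1 : x = a
    · subst h1
      simp only [if_true, h, if_false]
      rw [mul_mul_mul_self_of_anticommute hsq hac h, ← mul_assoc, hsq, one_mul]
      module
    · by_cases h2 : x = b
      · subst h2
        simp only [h1, if_true, if_false]
        rw [← mul_assoc, mul_mul_mul_self_of_anticommute hsq hac h.symm, mul_assoc, hsq, mul_one]
        module
      · simp only [h1, h2, if_false, add_zero, sub_zero]
        rw [mul_assoc, hac b x (Ne.symm h2), mul_neg, ← mul_assoc, hac a x (Ne.symm h1), neg_mul,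
          neg_neg, mul_assoc]
  simp [combo, Finset.mul_sum, Finset.sum_mul, this, Finset.sum_add_distrib,
    Finset.sum_sub_distrib]

/-- The spin double cover: half angles in the rotor, full angle on vectors. After the double-angle
formulas it is a polynomial identity modulo `c² + s² = 1`. -/
theorem rotor_mul_combo (hsq : ∀ a, γ a * γ a = 1)
    (hac : ∀ a b, a ≠ b → γ a * γ b = -(γ b * γ a)) {a b : ι} (h : a ≠ b) (θ : ℝ)
    (v : ι → ℝ) : rotor γ a b θ * combo γ v =
      combo γ (planeRot a b (Real.cos θ) (Real.sin θ) v) * rotor γ a b θ := by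
  have hθ : θ = 2 * (θ / 2) := by ring
  have hc : Real.cos θ = 1 - 2 * Real.sin (θ / 2) ^ 2 := by
    conv_lhs => rw [hθ, Real.cos_two_mul]
    linarith [Real.cos_sq_add_sin_sq (θ / 2)]
  have hs : Real.sin θ = 2 * Real.sin (θ / 2) * Real.cos (θ / 2) := by
    conv_lhs => rw [hθ, Real.sin_two_mul]
  have h1 : γ a * (γ a * γ b) = γ b := by rw [← mul_assoc, hsq, one_mul]
  have h2 : γ b * (γ a * γ b) = -γ a := by
    rw [← mul_assoc, mul_mul_mul_self_of_anticommute hsq hac h.symm]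
  rw [combo_planeRot h, hc, hs]
  have hp := Real.cos_sq_add_sin_sq (θ / 2)
  unfold rotor
  generalize Real.cos (θ / 2) = c at *
  generalize Real.sin (θ / 2) = s at *
  simp only [add_mul, mul_add, smul_mul_assoc, mul_smul_comm, pair_mul_combo hsq hac h, h1, h2,
    one_mul, mul_one]
  have hp' : c ^ 2 = 1 - s ^ 2 := by linarith
  match_scalars
  · ring
  · ring
  · linear_combination (-2 * s * v b) * hp'
  · linear_combination (2 * s * v a) * hp'

end Clifford

end Matchgate

/-! ### Reduction of unit vectors over ℤ[1/√2] by π/4 plane rotations. -/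

namespace Matchgate

theorem intCast_add_mul_sqrt_two_eq_zero {a b : ℤ} (h : (a : ℝ) + b * √2 = 0) : a = 0 ∧ b = 0 := by
  have hb : b = 0 := by
    by_contra hb
    refine irrational_sqrt_two ⟨-a / b, ?_⟩
    have : (b : ℝ) ≠ 0 := by exact_mod_cast hb
    push_cast
    field_simp
    linarith
  subst hb
  simpa using h

theorem exists_ne_odd_of_even_sum {ι : Type*} [Fintype ι] [DecidableEq ι] {f : ι → ℤ}
    (h : Even (∑ x, f x)) {x : ι} (hx : Odd (f x)) : ∃ y, y ≠ x ∧ Odd (f y) := by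
  by_contra! hne
  have h1 : Even (∑ y ∈ Finset.univ.erase x, f y) :=
    Finset.even_sum _ fun y hy => Int.not_odd_iff_even.mp (hne y (Finset.ne_of_mem_erase hy))
  rw [← Finset.add_sum_erase _ _ (Finset.mem_univ x)] at h
  exact Int.not_even_iff_odd.mpr (hx.add_even h1) h

section

variable {ι : Type*} [DecidableEq ι] {a b : ι}

theorem planeRot_apply_of_ne {x : ι} (ha : x ≠ a) (hb : x ≠ b) (c s : ℝ) (v : ι → ℝ) :
    planeRot a b c s v x = v x := by simp [planeRot, ha, hb]

theorem planeRot_apply_left (c s : ℝ) (v : ι → ℝ) :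
    planeRot a b c s v a = c * v a + s * v b := by simp [planeRot]

theorem planeRot_apply_right (h : a ≠ b) (c s : ℝ) (v : ι → ℝ) :
    planeRot a b c s v b = c * v b - s * v a := by simp [planeRot, h.symm]

theorem planeRot_planeRot_sqrt (h : a ≠ b) (v : ι → ℝ) :
    planeRot a b (√2)⁻¹ (√2)⁻¹ (planeRot a b (√2)⁻¹ (√2)⁻¹ v) = planeRot a b 0 1 v := by
  have h2 : (√2)⁻¹ * (√2)⁻¹ = (1 / 2 : ℝ) := by
    rw [← mul_inv, Real.mul_self_sqrt (by norm_num)]; norm_num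
  funext x
  by_cases ha : x = a
  · subst ha
    simp only [planeRot_apply_left, planeRot_apply_right h]
    linear_combination (2 * v b) * h2
  · by_cases hb : x = b
    · subst hb
      simp only [planeRot_apply_left, planeRot_apply_right h]
      linear_combination (-2 * v a) * h2
    · simp only [planeRot_apply_of_ne ha hb]

theorem sum_planeRot_sq [Fintype ι] (h : a ≠ b) {c s : ℝ} (hcs : c ^ 2 + s ^ 2 = 1)
    (v : ι → ℝ) : ∑ x, planeRot a b c s v x ^ 2 = ∑ x, v x ^ 2 := by
  have : ∀ x, planeRot a b c s v x ^ 2 = v x ^ 2 +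
      (if x = a then (c * v a + s * v b) ^ 2 - v a ^ 2 else 0) +
      (if x = b then (c * v b - s * v a) ^ 2 - v b ^ 2 else 0) := by
    intro x
    by_cases ha : x = a
    · subst ha; simp [planeRot_apply_left, h]
    · by_cases hb : x = b
      · subst hb; simp [planeRot_apply_right h, ha]
      · simp [planeRot_apply_of_ne ha hb, ha, hb]
  simp only [this, Finset.sum_add_distrib, Finset.sum_ite_eq', Finset.mem_univ, if_true]
  linear_combination (v a ^ 2 + v b ^ 2) * hcs

end

/-- Expand `∑ (α + β√2)² = 2 ^ k` and compare the rational and √2 parts. -/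
theorem sum_sq_and_sum_mul {ι : Type*} [Fintype ι] {k : ℕ} {α β : ι → ℤ} {v : ι → ℝ}
    (hv : ∀ x, v x * √2 ^ k = α x + β x * √2) (hn : ∑ x, v x ^ 2 = 1) :
    ∑ x, (α x ^ 2 + 2 * β x ^ 2) = 2 ^ k ∧ ∑ x, α x * β x = 0 := by
  have h2 : √2 ^ 2 = 2 := Real.sq_sqrt (by norm_num)
  have h1 : ∑ x, ((α x : ℝ) + β x * √2) ^ 2 = 2 ^ k := by
    simp only [← hv, mul_pow, ← Finset.sum_mul, hn, one_mul]
    rw [← pow_mul, mul_comm, pow_mul, h2]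
  have h3 : ((∑ x, (α x ^ 2 + 2 * β x ^ 2) - 2 ^ k : ℤ) : ℝ) +
      ((2 * ∑ x, α x * β x : ℤ) : ℝ) * √2 = 0 := by
    push_cast
    rw [← h1, Finset.mul_sum, Finset.sum_mul, sub_add_eq_add_sub, ← Finset.sum_add_distrib,
      sub_eq_zero]
    refine Finset.sum_congr rfl fun x _ => ?_
    linear_combination (-(β x : ℝ) ^ 2) * h2
  obtain ⟨h4, h5⟩ := intCast_add_mul_sqrt_two_eq_zero h3
  constructor <;> linarith

section Reduction

variable {ι : Type*} [DecidableEq ι] {t : Finset ι} {P : (ι → ℝ) → Prop}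

/-- Quarter turns send `±e_x` to `e_j`; the orientation of the plane absorbs the sign. For `x = j` a
single quarter turn cannot fix the sign, so the vector is first moved to the spare coordinate `y`.
-/
theorem reduce_signed_unit {j y : ι} (hj : j ∈ t) (hy : y ∈ t) (hyj : y ≠ j)
    (hP : ∀ a ∈ t, ∀ b ∈ t, a ≠ b → ∀ v, P (planeRot a b (√2)⁻¹ (√2)⁻¹ v) → P v)
    (h1 : P (Pi.single j 1)) {x : ι} (hx : x ∈ t) {v : ι → ℝ} (hv : ∀ z, z ≠ x → v z = 0)
    (hvx : v x = 1 ∨ v x = -1) : P v := by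
  have hP2 : ∀ a ∈ t, ∀ b ∈ t, a ≠ b → ∀ v, P (planeRot a b 0 1 v) → P v := by
    intro a ha b hb hab v h
    rw [← planeRot_planeRot_sqrt hab] at h
    exact hP a ha b hb hab _ (hP a ha b hb hab _ h)
  have hne : ∀ x ∈ t, x ≠ j → ∀ v : ι → ℝ, (∀ z, z ≠ x → v z = 0) →
      (v x = 1 ∨ v x = -1) → P v := by
    intro x hx hxj v hv hvx
    rcases hvx with hvx | hvx
    · refine hP2 j hj x hx hxj.symm v ?_
      convert h1 using 1
      funext z
      by_cases h2 : z = j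
      · subst h2; simp [planeRot_apply_left, hvx]
      · by_cases h3 : z = x
        · subst h3; simp [planeRot_apply_right hxj.symm, hv j hxj.symm, h2]
        · simp [planeRot_apply_of_ne h2 h3, h2, hv z h3]
    · refine hP2 x hx j hj hxj v ?_
      convert h1 using 1
      funext z
      by_cases h2 : z = j
      · subst h2; simp [planeRot_apply_right hxj, hvx]
      · by_cases h3 : z = x
        · subst h3; simp [planeRot_apply_left, hv j hxj.symm, h2]
        · simp [planeRot_apply_of_ne h3 h2, h2, hv z h3]
  by_cases hxj : x = j
  · subst hxj
    refine hP2 y hy x hx hyj v (hne y hy hyj _ ?_ ?_)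
    · intro z hz
      by_cases h3 : z = x
      · subst h3; simp [planeRot_apply_right hyj, hv y hyj]
      · simp [planeRot_apply_of_ne hz h3, hv z h3]
    · simpa [planeRot_apply_left] using hvx
  · exact hne x hx hxj v hv hvx

variable [Fintype ι]

/-- Two odd entries with the same residue modulo `2`. -/
theorem exists_odd_pair {k : ℕ} {α β : ι → ℤ} (hk : k ≠ 0)
    (h1 : ∑ x, (α x ^ 2 + 2 * β x ^ 2) = 2 ^ k) (h2 : ∑ x, α x * β x = 0) {x : ι}
    (hx : Odd (α x)) : ∃ y, y ≠ x ∧ Odd (α y) ∧ Even (β x + β y) := by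
  rcases Int.even_or_odd (β x) with hb | hb
  · have h3 : Even (∑ x, (α x * (α x + β x))) := by
      have : ∑ x, (α x * (α x + β x)) =
          ∑ x, (α x ^ 2 + 2 * β x ^ 2) + ∑ x, α x * β x - 2 * ∑ x, β x ^ 2 := by
        rw [Finset.mul_sum, ← Finset.sum_add_distrib, ← Finset.sum_sub_distrib]
        exact Finset.sum_congr rfl fun x _ => by ring
      rw [this, h1, h2]
      obtain ⟨m, rfl⟩ := Nat.exists_eq_succ_of_ne_zero hk
      exact ⟨2 ^ m - ∑ x, β x ^ 2, by rw [pow_succ]; ring⟩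
    obtain ⟨y, hy, hy2⟩ := exists_ne_odd_of_even_sum h3 (hx.mul (hx.add_even hb))
    rw [Int.odd_mul] at hy2
    refine ⟨y, hy, hy2.1, hb.add ?_⟩
    by_contra hc
    exact Int.not_even_iff_odd.mpr hy2.2 (hy2.1.add_odd (Int.not_even_iff_odd.mp hc))
  -- For odd `β x`, the relation `∑ α β = 0` alone supplies the partner.
  · have h3 : Even (∑ x, α x * β x) := by rw [h2]; exact Even.zero
    obtain ⟨y, hy, hy2⟩ := exists_ne_odd_of_even_sum h3 (hx.mul hb)
    rw [Int.odd_mul] at hy2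
    exact ⟨y, hy, hy2.1, hb.add_odd hy2.2⟩

theorem exists_unit_of_sum_eq_one {α β : ι → ℤ}
    (h : ∑ x, (α x ^ 2 + 2 * β x ^ 2) = 1) :
    (∀ x, β x = 0) ∧ ∃ x, (α x = 1 ∨ α x = -1) ∧ ∀ z, z ≠ x → α z = 0 := by
  have hpos : ∀ x ∈ Finset.univ, 0 ≤ α x ^ 2 + 2 * β x ^ 2 := fun x _ => by positivity
  have hβ : ∀ x, β x = 0 := by
    intro x
    have h1 := Finset.single_le_sum hpos (Finset.mem_univ x)
    rw [h] at h1
    by_contra hb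
    have : 0 < β x ^ 2 := by positivity
    nlinarith [sq_nonneg (α x)]
  refine ⟨hβ, ?_⟩
  obtain ⟨x, -, hx⟩ := Finset.exists_ne_zero_of_sum_ne_zero (h.trans_ne one_ne_zero)
  rw [hβ x] at hx
  have hx0 : α x ≠ 0 := by rintro h0; simp [h0] at hx
  rw [← Finset.add_sum_erase _ _ (Finset.mem_univ x)] at h
  have hge : 0 ≤ ∑ y ∈ Finset.univ.erase x, (α y ^ 2 + 2 * β y ^ 2) :=
    Finset.sum_nonneg fun y _ => hpos y (Finset.mem_univ y)
  have hsq : 0 < α x ^ 2 := by positivity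
  have h1 : α x ^ 2 = 1 := by nlinarith [sq_nonneg (β x)]
  refine ⟨x, mul_self_eq_one_iff.mp (by rw [← sq, h1]), fun z hz => ?_⟩
  have h0 : ∑ y ∈ Finset.univ.erase x, (α y ^ 2 + 2 * β y ^ 2) = 0 := by
    rw [hβ x, h1] at h; linarith
  have h4 := (Finset.sum_eq_zero_iff_of_nonneg fun y _ => hpos y (Finset.mem_univ y)).mp h0 z
    (Finset.mem_erase.mpr ⟨hz, Finset.mem_univ z⟩)
  rw [hβ z] at h4
  simpa using h4

/-- Unit vectors over `ℤ[1/√2]` reduce to a basis vector by plane rotations through `π/4`. -/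
theorem reduce_unit_vector {j y : ι} (hj : j ∈ t) (hy : y ∈ t) (hyj : y ≠ j)
    (hP : ∀ a ∈ t, ∀ b ∈ t, a ≠ b → ∀ v, P (planeRot a b (√2)⁻¹ (√2)⁻¹ v) → P v)
    (h1 : P (Pi.single j 1)) (k m : ℕ) (α β : ι → ℤ) (v : ι → ℝ)
    (hm : (Finset.univ.filter fun x => Odd (α x)).card = m)
    (hv : ∀ x, v x * √2 ^ k = α x + β x * √2) (hs : ∀ x, x ∉ t → v x = 0)
    (hn : ∑ x, v x ^ 2 = 1) : P v := by
  have h2 : √2 * √2 = 2 := Real.mul_self_sqrt (by norm_num)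
  have hne : √2 ≠ 0 := by positivity
  -- Outer induction on the denominator exponent `k`, inner strong induction on the number `m` of
  -- odd `α`.
  induction k generalizing m α β v with
  | zero =>
    obtain ⟨hβ, x, hx, hz⟩ := exists_unit_of_sum_eq_one (sum_sq_and_sum_mul hv hn).1
    have hv' : ∀ z, v z = α z := fun z => by simpa [hβ z] using hv z
    have hvx : v x = 1 ∨ v x = -1 := by
      rw [hv' x]; rcases hx with hx | hx <;> simp [hx]
    have hxt : x ∈ t := by
      by_contra hxt
      rw [hs x hxt] at hvx
      norm_num at hvx
    exact reduce_signed_unit hj hy hyj hP h1 hxt (fun z hzx => by simp [hv', hz z hzx]) hvx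
  | succ k ihk =>
    induction m using Nat.strong_induction_on generalizing α β v with
    | _ m ihm =>
      obtain ⟨hsq, hmul⟩ := sum_sq_and_sum_mul hv hn
      by_cases hodd : ∃ x, Odd (α x)
      · obtain ⟨x, hx⟩ := hodd
        obtain ⟨z, hzx, hz, hβ⟩ := exists_odd_pair (Nat.succ_ne_zero k) hsq hmul hx
        have hmem : ∀ x, Odd (α x) → x ∈ t := by
          intro x hx
          by_contra hxt
          have h3 := hv x
          rw [hs x hxt, zero_mul] at h3
          rw [(intCast_add_mul_sqrt_two_eq_zero h3.symm).1] at hx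
          exact absurd hx (by decide)
        refine hP x (hmem x hx) z (hmem z hz) hzx.symm v ?_
        obtain ⟨p, hp⟩ := hx.add_odd hz
        obtain ⟨r, hr⟩ := hz.sub_odd hx
        -- With `α x + α z = 2p` and `α z - α x = 2r`, dividing by √2 gives the new numerators `(β x
        -- + β z) + p√2` and `(β z - β x) + r√2`. Their rational parts are even by the choice of
        -- `z`, so `m` decreases.
        let α' : ι → ℤ := fun w => if w = x then β x + β z else if w = z then β z - β x else α w
        let β' : ι → ℤ := fun w => if w = x then p else if w = z then r else β w
        have hβ' : Even (β z - β x) := by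
          rw [Int.even_sub, ← Int.even_add, add_comm]; exact hβ
        refine ihm (Finset.univ.filter fun x => Odd (α' x)).card ?_ α' β' _ rfl ?_ ?_ ?_
        · rw [← hm]
          refine Finset.card_lt_card ⟨?_, ?_⟩
          · intro w
            simp only [Finset.mem_filter, Finset.mem_univ, true_and, α']
            split_ifs with h3 h4
            · subst h3; exact fun _ => hx
            · subst h4; exact fun _ => hz
            · exact id
          · intro hsub
            have h3 := hsub (Finset.mem_filter.mpr ⟨Finset.mem_univ x, hx⟩)
            simp only [Finset.mem_filter, Finset.mem_univ, true_and, α', if_true] at h3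
            exact Int.not_even_iff_odd.mpr h3 hβ
        · have hp' : (α x : ℝ) + α z = p + p := by exact_mod_cast hp
          have hr' : (α z : ℝ) - α x = r + r := by exact_mod_cast hr
          have key : ∀ u w : ℝ, √2 * u = √2 * w → u = w := fun u w => mul_left_cancel₀ hne
          intro w
          by_cases h3 : w = x
          · subst h3
            simp only [planeRot_apply_left, α', β', if_true]
            push_cast
            apply key
            have h4 : √2 * (((√2)⁻¹ * v w + (√2)⁻¹ * v z) * √2 ^ (k + 1)) =
              v w * √2 ^ (k + 1) + v z * √2 ^ (k + 1) := by field_simp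
            rw [h4, hv, hv]
            linear_combination hp' - p * h2
          · by_cases h4 : w = z
            · subst h4
              simp only [planeRot_apply_right hzx.symm, α', β', if_true, h3, if_false]
              push_cast
              apply key
              have h4 : √2 * (((√2)⁻¹ * v w - (√2)⁻¹ * v x) * √2 ^ (k + 1)) =
                v w * √2 ^ (k + 1) - v x * √2 ^ (k + 1) := by field_simp
              rw [h4, hv, hv]
              linear_combination hr' - r * h2
            · simp only [planeRot_apply_of_ne h3 h4, α', β', h3, h4, if_false]
              exact hv w
        · intro w hw
          rw [planeRot_apply_of_ne, hs w hw]
          · rintro rfl; exact hw (hmem _ hx)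
          · rintro rfl; exact hw (hmem _ hz)
        · rw [sum_planeRot_sq hzx.symm, hn]
          rw [inv_pow, sq, h2]; norm_num
      · push Not at hodd
        -- All `α = 2δ` are even: cancelling one √2 turns `α + β√2` into `β + δ√2`.
        choose δ hδ using fun x => Int.not_odd_iff_even.mp (hodd x)
        refine ihk _ β δ v rfl (fun x => ?_) hs hn
        have h3 := hv x
        rw [hδ x] at h3
        push_cast at h3
        refine mul_right_cancel₀ hne ?_
        rw [pow_succ] at h3
        linear_combination h3 - δ x * h2

end Reduction

end Matchgate

/-! ### Matchgates as rotors, their invariants, and arithmetic of the coefficients. -/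

namespace Matchgate

/-- Sending `i` to `K` is a continuous algebra map from ℂ, and it transports Euler's formula. -/
theorem exp_smul_of_mul_self_eq_neg_one {m : Type*} [Fintype m] [DecidableEq m]
    (K : Matrix m m ℂ) (hK : K * K = -1) (t : ℝ) :
    NormedSpace.exp (t • K) = Real.cos t • (1 : Matrix m m ℂ) + Real.sin t • K := by
  open scoped Matrix.Norms.Operator in
  have hc : Continuous (Complex.liftAux K hK) :=
    LinearMap.continuous_of_finiteDimensional (Complex.liftAux K hK).toLinearMap
  open scoped Matrix.Norms.Operator in
  have h := NormedSpace.map_exp (Complex.liftAux K hK) hc (t * Complex.I)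
  rw [← Complex.exp_eq_exp_ℂ, Complex.exp_mul_I] at h
  simp only [Complex.liftAux_apply, ← Complex.ofReal_cos, ← Complex.ofReal_sin] at h
  simp [Algebra.algebraMap_eq_smul_one, Complex.cos_ofReal_re, Complex.sin_ofReal_re] at h
  exact h.symm

variable {n : ℕ}

theorem exp_smul_eq_rotor {H : QOp n} {a b : Fin n × Fin 2} (hab : a ≠ b)
    (h : majorana a * majorana b = Complex.I • H) (θ : ℝ) :
    NormedSpace.exp ((Complex.I * (θ : ℂ) / 2) • H) = rotor majorana a b θ := by
  rw [rotor, ← exp_smul_of_mul_self_eq_neg_one _ (mul_mul_mul_pair_self majorana_mul_self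
    (fun _ _ => majorana_anticommute) hab), h]
  congr 1
  ext x y
  simp only [Matrix.smul_apply, Complex.real_smul, smul_eq_mul]
  push_cast
  ring

theorem coe_Rz (q : Fin n) (θ : ℝ) : (Rz q θ : QOp n) = rotor majorana (q, 0) (q, 1) θ :=
  exp_smul_eq_rotor (by simp) (majorana_mul_majorana_same q) θ

theorem coe_Rxx {p q : Fin n} (h : p.val + 1 = q.val) (θ : ℝ) :
    (Rxx p q θ : QOp n) = rotor majorana (p, 1) (q, 0) θ :=
  exp_smul_eq_rotor (by simp) (majorana_mul_majorana_succ h) θ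

theorem coe_inv_of_coe_eq_rotor {a b : Fin n × Fin 2} (hab : a ≠ b) {θ : ℝ}
    {U : Matrix.unitaryGroup (Fin n → Fin 2) ℂ} (hU : (U : QOp n) = rotor majorana a b θ) :
    ((U⁻¹ : Matrix.unitaryGroup (Fin n → Fin 2) ℂ) : QOp n) = rotor majorana a b (-θ) := by
  have h1 : (U : QOp n) * rotor majorana a b (-θ) = 1 := by
    rw [hU, rotor_mul_rotor majorana_mul_self (fun _ _ => majorana_anticommute) hab,
      add_neg_cancel, rotor_zero]
  have h2 : ((U⁻¹ : Matrix.unitaryGroup (Fin n → Fin 2) ℂ) : QOp n) * (U : QOp n) = 1 :=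
    congrArg Subtype.val (inv_mul_cancel U)
  exact left_inv_eq_right_inv h2 h1

/-- Inverses need no case of their own: the inverse of a generator is the rotor with opposite angle.
-/
theorem matchgate_induction {p : QOp n → Prop}
    (hz : ∀ (q : Fin n) (θ : ℝ), p (rotor majorana (q, 0) (q, 1) θ))
    (hxx : ∀ (q r : Fin n) (θ : ℝ), q.val + 1 = r.val → p (rotor majorana (q, 1) (r, 0) θ))
    (one : p 1) (mul : ∀ A B, p A → p B → p (A * B))
    {U : Matrix.unitaryGroup (Fin n → Fin 2) ℂ} (hU : U ∈ matchgateGroup n) : p U := by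
  unfold matchgateGroup at hU
  induction hU using Subgroup.closure_induction'' with
  | mem U h =>
    rcases h with ⟨q, θ, rfl⟩ | ⟨q, r, θ, hqr, rfl⟩
    · rw [coe_Rz]; exact hz q θ
    · rw [coe_Rxx hqr]; exact hxx q r θ hqr
  | inv_mem U h =>
    rcases h with ⟨q, θ, rfl⟩ | ⟨q, r, θ, hqr, rfl⟩
    · rw [coe_inv_of_coe_eq_rotor (by simp) (coe_Rz q θ)]; exact hz q _
    · rw [coe_inv_of_coe_eq_rotor (by simp) (coe_Rxx hqr θ)]; exact hxx q r _ hqr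
  | one => exact one
  | mul U V _ _ h1 h2 => exact mul _ _ h1 h2

theorem exists_combo_of_mem_matchgateGroup {U : Matrix.unitaryGroup (Fin n → Fin 2) ℂ}
    (hU : U ∈ matchgateGroup n) (v : Fin n × Fin 2 → ℝ) :
    ∃ w, (U : QOp n) * combo majorana v = combo majorana w * (U : QOp n) := by
  have key : ∀ a b : Fin n × Fin 2, a ≠ b → ∀ θ v, ∃ w,
      rotor majorana a b θ * combo majorana v = combo majorana w * rotor majorana a b θ :=
    fun a b hab θ v =>
      ⟨_, rotor_mul_combo majorana_mul_self (fun _ _ => majorana_anticommute) hab θ v⟩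
  revert v
  refine matchgate_induction (p := fun M => ∀ v, ∃ w, M * combo majorana v = combo majorana w * M)
    (fun q θ => key _ _ (by simp) θ) (fun q r θ _ => key _ _ (by simp) θ)
    (fun v => ⟨v, by simp⟩) ?_ hU
  intro A B hA hB v
  obtain ⟨w, hw⟩ := hB v
  obtain ⟨u, hu⟩ := hA w
  exact ⟨u, by rw [mul_assoc, hw, ← mul_assoc, hu, mul_assoc]⟩

theorem parity_mul_of_mem_matchgateGroup {U : Matrix.unitaryGroup (Fin n → Fin 2) ℂ}
    (hU : U ∈ matchgateGroup n) : parity n * (U : QOp n) = U * parity n := by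
  have key : ∀ (a b : Fin n × Fin 2) (θ : ℝ),
      parity n * rotor majorana a b θ = rotor majorana a b θ * parity n := by
    intro a b θ
    have : parity n * (majorana a * majorana b) = majorana a * majorana b * parity n := by
      rw [← mul_assoc, parity_mul_majorana, neg_mul, mul_assoc, parity_mul_majorana, mul_neg,
        neg_neg, mul_assoc]
    simp only [rotor, mul_add, add_mul, mul_smul_comm, smul_mul_assoc, this, one_mul, mul_one]
  refine matchgate_induction (p := fun M => parity n * M = M * parity n)
    (fun q θ => key _ _ θ) (fun q r θ _ => key _ _ θ) (by simp) (fun A B hA hB => ?_) hU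
  rw [← mul_assoc, hA, mul_assoc, hB, mul_assoc]

theorem rotor_mul_spinForm_mul_transpose {H : QOp n} {a b : Fin n × Fin 2} (hab : a ≠ b)
    (h : majorana a * majorana b = Complex.I • H)
    (hH : H * spinForm n = -(spinForm n * H.transpose)) (θ : ℝ) :
    rotor majorana a b θ * spinForm n * (rotor majorana a b θ).transpose = spinForm n := by
  have hsq := mul_mul_mul_pair_self majorana_mul_self (fun _ _ => majorana_anticommute) hab
  rw [rotor]
  generalize majorana a * majorana b = K at *
  have h1 : K * spinForm n = -(spinForm n * K.transpose) := by
    rw [h, Matrix.transpose_smul, smul_mul_assoc, hH, mul_smul_comm, smul_neg]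
  have h2 : K * spinForm n * K.transpose = spinForm n := by
    rw [h1, neg_mul, mul_assoc, ← Matrix.transpose_mul, hsq]
    simp
  have hp := Real.cos_sq_add_sin_sq (θ / 2)
  generalize Real.cos (θ / 2) = c at *
  generalize Real.sin (θ / 2) = s at *
  simp only [Matrix.transpose_add, Matrix.transpose_smul, Matrix.transpose_one, add_mul, mul_add,
    smul_mul_assoc, mul_smul_comm, one_mul, mul_one, h2]
  rw [h1]
  match_scalars
  · linear_combination hp
  · ring

theorem mul_spinForm_mul_transpose {U : Matrix.unitaryGroup (Fin n → Fin 2) ℂ}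
    (hU : U ∈ matchgateGroup n) :
    (U : QOp n) * spinForm n * (U : QOp n).transpose = spinForm n := by
  refine matchgate_induction (p := fun M => M * spinForm n * M.transpose = spinForm n)
    (fun q θ => rotor_mul_spinForm_mul_transpose (by simp) (majorana_mul_majorana_same q)
      (onQubit_mul_spinForm q) θ)
    (fun q r θ h => rotor_mul_spinForm_mul_transpose (by simp) (majorana_mul_majorana_succ h)
      (opXX_mul_spinForm h) θ) (by simp) (fun A B hA hB => ?_) hU
  calc A * B * spinForm n * (A * B).transpose
      = A * (B * spinForm n * B.transpose) * A.transpose := by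
        rw [Matrix.transpose_mul]; simp only [mul_assoc]
    _ = spinForm n := by rw [hB, hA]

/-- The scalars in the matchgate group are `±1`. -/
theorem eq_one_or_neg_one_of_scalar {U : Matrix.unitaryGroup (Fin n → Fin 2) ℂ}
    (hU : U ∈ matchgateGroup n) {c : ℂ} (hc : (U : QOp n) = c • 1) :
    (U : QOp n) = 1 ∨ (U : QOp n) = -1 := by
  -- For a scalar, invariance reads `c² B = B` with `B` the form; since `B` is invertible, `c² = 1`.
  have h := mul_spinForm_mul_transpose hU
  obtain ⟨B, hB⟩ := exists_spinForm_mul_eq_one (n := n)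
  rw [hc, Matrix.transpose_smul, Matrix.transpose_one, smul_mul_assoc, one_mul, mul_smul_comm,
    mul_one, smul_smul] at h
  have h1 := congrArg (· * B) h
  simp only [smul_mul_assoc, hB] at h1
  have h2 : c * c = 1 := by simpa using congrFun (congrFun h1 0) 0
  rw [hc]
  rcases mul_self_eq_one_iff.mp h2 with rfl | rfl <;> simp

/-- Trace orthogonality extracts `2 ^ n * v a` as a sum of Majorana entries times products `U_jl *
conj U_ik`. These are entries of `U ⊗ U*`, so nothing is needed of the entries of `U` alone. -/
theorem coeff_mem_ringZ {U : Matrix.unitaryGroup (Fin n → Fin 2) ℂ}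
    (hring : ∀ a b : (Fin n → Fin 2) × (Fin n → Fin 2),
      Matrix.kronecker (U : QOp n) ((U : QOp n).map (starRingEnd ℂ)) a b ∈ ringZ)
    {b : Fin n × Fin 2} {v : Fin n × Fin 2 → ℝ}
    (hv : (U : QOp n) * majorana b = combo majorana v * (U : QOp n)) (a : Fin n × Fin 2) :
    (v a : ℂ) ∈ ringZ := by
  have hU : (U : QOp n) * (U : QOp n).conjTranspose = 1 := Matrix.mem_unitaryGroup_iff.mp U.2
  have h1 : (majorana a * ((U : QOp n) * majorana b * (U : QOp n).conjTranspose)).trace =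
      v a * 2 ^ n := by
    rw [hv, mul_assoc, hU, mul_one, combo, Finset.mul_sum, Matrix.trace_sum]
    simp only [mul_smul_comm, Matrix.trace_smul, trace_majorana_mul]
    simp
  have h2 : (majorana a * ((U : QOp n) * majorana b * (U : QOp n).conjTranspose)).trace ∈
      ringZ := by
    rw [Matrix.trace]
    simp only [Matrix.diag_apply, Matrix.mul_apply, Finset.sum_mul, Finset.mul_sum]
    refine Subring.sum_mem _ fun i _ => Subring.sum_mem _ fun j _ => Subring.sum_mem _ fun k _ =>
      Subring.sum_mem _ fun l _ => ?_
    have h3 : (U : QOp n) j l * starRingEnd ℂ ((U : QOp n) i k) ∈ ringZ := hring (j, i) (l, k)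
    rw [Matrix.conjTranspose_apply, ← starRingEnd_apply]
    have h4 := mul_mem (mul_mem (majorana_mem_ringZ a i j) (majorana_mem_ringZ b l k)) h3
    convert h4 using 1
    ring
  have h5 : ((1 / √2 : ℝ) : ℂ) ∈ ringZ := Subring.subset_closure (by simp)
  -- The factor `2 ^ n` is invertible in the ring, with inverse `(1/√2) ^ (2n)`.
  have h6 : ((1 / √2 : ℝ) : ℂ) ^ (2 * n) * (2 : ℂ) ^ n = 1 := by
    rw [pow_mul, ← mul_pow]
    norm_cast
    rw [div_pow, Real.sq_sqrt (by norm_num)]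
    norm_num
  have h7 := mul_mem (pow_mem h5 (2 * n)) h2
  rw [h1] at h7
  convert h7 using 1
  linear_combination -(v a : ℂ) * h6

theorem exists_int_of_mem_ringZ {z : ℂ} (hz : z ∈ ringZ) : ∃ (k : ℕ) (a b c d : ℤ),
    z * (√2 : ℂ) ^ k = (a + b * (√2 : ℂ)) + (c + d * (√2 : ℂ)) * Complex.I := by
  have h2 : (√2 : ℂ) * (√2 : ℂ) = 2 := by
    norm_cast
    exact Real.mul_self_sqrt (by norm_num)
  have hI : Complex.I * Complex.I = -1 := Complex.I_mul_I
  have hne : (√2 : ℂ) ≠ 0 := by intro h; simp [h] at h2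
  -- Raises the denominator exponent, by `√2 (a + b√2) = 2b + a√2`, so that sums get a common
  -- denominator.
  have lift : ∀ (z : ℂ) (k l : ℕ) (a b c d : ℤ),
      z * (√2 : ℂ) ^ k = (a + b * (√2 : ℂ)) + (c + d * (√2 : ℂ)) * Complex.I →
      ∃ a b c d : ℤ, z * (√2 : ℂ) ^ (k + l) =
        (a + b * (√2 : ℂ)) + (c + d * (√2 : ℂ)) * Complex.I := by
    intro z k l
    induction l with
    | zero => exact fun a b c d h => ⟨a, b, c, d, h⟩
    | succ l ih =>
      intro a b c d h
      obtain ⟨a, b, c, d, h⟩ := ih a b c d h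
      refine ⟨2 * b, a, 2 * d, c, ?_⟩
      rw [← add_assoc, pow_succ]
      push_cast
      linear_combination (√2 : ℂ) * h + (b + d * Complex.I) * h2
  unfold ringZ at hz
  induction hz using Subring.closure_induction with
  | mem z hz =>
    rcases hz with rfl | hz
    · refine ⟨1, 1, 0, 0, 0, ?_⟩
      push_cast
      field_simp
      ring
    · rw [Set.mem_singleton_iff] at hz
      exact ⟨0, 0, 0, 1, 0, by simp [hz]⟩
  | zero => exact ⟨0, 0, 0, 0, 0, by simp⟩
  | one => exact ⟨0, 1, 0, 0, 0, by simp⟩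
  | add x y _ _ hx hy =>
    obtain ⟨k, a, b, c, d, h⟩ := hx
    obtain ⟨l, a', b', c', d', h'⟩ := hy
    obtain ⟨a, b, c, d, h⟩ := lift _ _ l _ _ _ _ h
    obtain ⟨a', b', c', d', h'⟩ := lift _ _ k _ _ _ _ h'
    refine ⟨k + l, a + a', b + b', c + c', d + d', ?_⟩
    rw [add_mul, h, add_comm k l, h']
    push_cast
    ring
  | neg x _ hx =>
    obtain ⟨k, a, b, c, d, h⟩ := hx
    refine ⟨k, -a, -b, -c, -d, ?_⟩
    push_cast
    linear_combination -h
  | mul x y _ _ hx hy =>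
    obtain ⟨k, a, b, c, d, h⟩ := hx
    obtain ⟨l, a', b', c', d', h'⟩ := hy
    refine ⟨k + l, a * a' + 2 * b * b' - c * c' - 2 * d * d', a * b' + b * a' - c * d' - d * c',
      a * c' + 2 * b * d' + c * a' + 2 * d * b', a * d' + b * c' + c * b' + d * a', ?_⟩
    have : x * y * (√2 : ℂ) ^ (k + l) = (x * (√2 : ℂ) ^ k) * (y * (√2 : ℂ) ^ l) := by ring
    rw [this, h, h']
    push_cast
    generalize (√2 : ℂ) = r at *
    generalize Complex.I = i at *
    linear_combination (b * b' + b * d' * i + d * b' * i + d * d' * i * i) * h2 +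
      (c * c' + c * d' * r + d * c' * r + d * d' * 2) * hI

theorem exists_int_of_forall_mem_ringZ {ι : Type*} [Fintype ι] {v : ι → ℝ}
    (h : ∀ x, (v x : ℂ) ∈ ringZ) :
    ∃ (k : ℕ) (α β : ι → ℤ), ∀ x, v x * √2 ^ k = α x + β x * √2 := by
  have h2 : √2 * √2 = 2 := Real.mul_self_sqrt (by norm_num)
  have h1 : ∀ x, ∃ (k : ℕ) (a b : ℤ), v x * √2 ^ k = a + b * √2 := by
    intro x
    obtain ⟨k, a, b, c, d, h3⟩ := exists_int_of_mem_ringZ (h x)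
    refine ⟨k, a, b, ?_⟩
    have h4 := congrArg Complex.re h3
    rw [← Complex.ofReal_pow, ← Complex.ofReal_mul, Complex.ofReal_re] at h4
    simpa using h4
  choose k a b hk using h1
  have h3 : ∀ x l, ∃ a b : ℤ, v x * √2 ^ (k x + l) = a + b * √2 := by
    intro x l
    induction l with
    | zero => exact ⟨a x, b x, hk x⟩
    | succ l ih =>
      obtain ⟨a, b, h⟩ := ih
      refine ⟨2 * b, a, ?_⟩
      rw [← add_assoc, pow_succ]
      push_cast
      linear_combination √2 * h + b * h2
  -- The sum of all exponents serves as a common one.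
  have h4 : ∀ x, ∃ a b : ℤ, v x * √2 ^ (∑ y, k y) = a + b * √2 := by
    intro x
    have := h3 x (∑ y, k y - k x)
    rwa [Nat.add_sub_cancel' (Finset.single_le_sum (fun y _ => Nat.zero_le (k y))
      (Finset.mem_univ x))] at this
  choose α β hαβ using h4
  exact ⟨_, α, β, hαβ⟩

end Matchgate

/-! ### Synthesis from the gate set. -/

namespace Matchgate

variable {n : ℕ}

/-- The group generated by the gate set. -/
def synthGroup (n : ℕ) : Subgroup (Matrix.unitaryGroup (Fin n → Fin 2) ℂ) :=
  Subgroup.closure (gateSet n)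

theorem synthGroup_le_matchgateGroup : synthGroup n ≤ matchgateGroup n := by
  refine (Subgroup.closure_le _).mpr ?_
  rintro g ((⟨q, rfl⟩ | ⟨q, rfl⟩) | ⟨p, q, h, rfl⟩)
  · exact Subgroup.subset_closure (Or.inl ⟨q, _, rfl⟩)
  · exact Subgroup.subset_closure (Or.inl ⟨q, _, rfl⟩)
  · exact Subgroup.subset_closure (Or.inr ⟨p, q, _, h, rfl⟩)

/-- Rotors have period 4π, so the π/4 gates satisfy `g ^ 16 = 1` and the π/2 gates already `g ^ 8 =
1`. One common exponent lets `g ^ 15` replace `g⁻¹`. -/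
theorem pow_sixteen_of_mem_gateSet {g : Matrix.unitaryGroup (Fin n → Fin 2) ℂ}
    (hg : g ∈ gateSet n) : g ^ 16 = 1 := by
  have key : ∀ {a b : Fin n × Fin 2}, a ≠ b → ∀ {θ : ℝ} (k : ℕ), k * θ = 4 * Real.pi →
      (g : QOp n) = rotor majorana a b θ → g ^ k = 1 := by
    intro a b hab θ k hk hg
    apply Subtype.ext
    rw [SubmonoidClass.coe_pow, hg,
      rotor_pow majorana_mul_self (fun _ _ => majorana_anticommute) hab, hk, rotor_four_pi]
    rfl
  have h16 : g ^ 16 = (g ^ 8) ^ 2 := by rw [← pow_mul]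
  rcases hg with (⟨q, rfl⟩ | ⟨q, rfl⟩) | ⟨p, q, h, rfl⟩
  · exact key (by simp) 16 (by push_cast; ring) (coe_Rz q _)
  · rw [h16, key (by simp) 8 (by push_cast; ring) (coe_Rz q _), one_pow]
  · rw [h16, key (by simp) 8 (by push_cast; ring) (coe_Rxx h _), one_pow]

theorem exists_list_of_mem_synthGroup {U : Matrix.unitaryGroup (Fin n → Fin 2) ℂ}
    (hU : U ∈ synthGroup n) :
    ∃ L : List (Matrix.unitaryGroup (Fin n → Fin 2) ℂ), (∀ g ∈ L, g ∈ gateSet n) ∧ U = L.prod := by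
  have h : U ∈ Submonoid.closure (gateSet n) := by
    unfold synthGroup at hU
    induction hU using Subgroup.closure_induction'' with
    | mem g hg => exact Submonoid.subset_closure hg
    | inv_mem g hg =>
      rw [inv_eq_of_mul_eq_one_right (b := g ^ 15)
        (by rw [← pow_succ']; exact pow_sixteen_of_mem_gateSet hg)]
      exact pow_mem (Submonoid.subset_closure hg) 15
    | one => exact one_mem _
    | mul U V _ _ h1 h2 => exact mul_mem h1 h2
  obtain ⟨L, hL, h1⟩ := Submonoid.exists_list_of_mem_closure h
  exact ⟨L, hL, h1.symm⟩

/-- The rotor in the plane `a`, `b` with angle `θ` is generated by the gate set. -/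
def RotorSynth (θ : ℝ) (a b : Fin n × Fin 2) : Prop :=
  ∃ V ∈ synthGroup n, (V : QOp n) = rotor majorana a b θ

theorem RotorSynth.symm {θ : ℝ} {a b : Fin n × Fin 2} (hab : a ≠ b) (h : RotorSynth θ a b) :
    RotorSynth θ b a := by
  obtain ⟨V, hV, h⟩ := h
  refine ⟨V⁻¹, inv_mem hV, ?_⟩
  rw [coe_inv_of_coe_eq_rotor hab h, rotor_swap (fun _ _ => majorana_anticommute) hab]

theorem RotorSynth.trans {θ : ℝ} {a b c : Fin n × Fin 2} (hab : a ≠ b) (hac : a ≠ c)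
    (h : RotorSynth θ a b) (h' : RotorSynth (Real.pi / 2) b c) : RotorSynth θ a c := by
  obtain ⟨V, hV, h⟩ := h
  obtain ⟨W, hW, h'⟩ := h'
  refine ⟨W⁻¹ * (V * W), mul_mem (inv_mem hW) (mul_mem hV hW), ?_⟩
  have h1 : ((W⁻¹ : Matrix.unitaryGroup (Fin n → Fin 2) ℂ) : QOp n) * (W : QOp n) = 1 :=
    congrArg Subtype.val (inv_mul_cancel W)
  have h2 : ((W⁻¹ * (V * W) : Matrix.unitaryGroup (Fin n → Fin 2) ℂ) : QOp n) =
    ((W⁻¹ : Matrix.unitaryGroup (Fin n → Fin 2) ℂ) : QOp n) * ((V : QOp n) * (W : QOp n)) := rfl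
  rw [h2, h, h', rotor_mul_rotor_pi_div_two majorana_mul_self (fun _ _ => majorana_anticommute)
    hab hac, ← h', ← mul_assoc, h1, one_mul]

/-- The planes of the π/2 gates form a path through all Majoranas. `RotorSynth.trans` walks from the
endpoint `o` to any Majorana, and two such walks join `a` to `b`. -/
theorem rotorSynth_pi_div_two {a b : Fin n × Fin 2} (hab : a ≠ b) :
    RotorSynth (Real.pi / 2) a b := by
  have hn : 0 < n := a.1.pos
  let o : Fin n × Fin 2 := (⟨0, hn⟩, 0)
  have hz : ∀ q : Fin n, RotorSynth (Real.pi / 2) (q, 0) (q, 1) := fun q =>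
    ⟨Sbar q, Subgroup.subset_closure (Or.inl (Or.inr ⟨q, rfl⟩)), coe_Rz q _⟩
  have hxx : ∀ p q : Fin n, p.val + 1 = q.val → RotorSynth (Real.pi / 2) (p, 1) (q, 0) :=
    fun p q h => ⟨Rxx p q _, Subgroup.subset_closure (Or.inr ⟨p, q, h, rfl⟩), coe_Rxx h _⟩
  have step : ∀ a b : Fin n × Fin 2, (o = a ∨ RotorSynth (Real.pi / 2) o a) →
      RotorSynth (Real.pi / 2) a b → (o = b ∨ RotorSynth (Real.pi / 2) o b) := by
    intro a b h1 h2
    by_cases hob : o = b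
    · exact Or.inl hob
    by_cases hoa : o = a
    · subst hoa; exact Or.inr h2
    · exact Or.inr ((h1.resolve_left hoa).trans hoa hob h2)
  have h0 : ∀ (q : ℕ) (hq : q < n), o = (⟨q, hq⟩, 0) ∨ RotorSynth (Real.pi / 2) o (⟨q, hq⟩, 0) := by
    intro q
    induction q with
    | zero => exact fun _ => Or.inl rfl
    | succ q ih =>
      intro hq
      exact step _ _ (step _ _ (ih (by omega)) (hz _)) (hxx ⟨q, by omega⟩ ⟨q + 1, hq⟩ rfl)
  have hall : ∀ a : Fin n × Fin 2, o = a ∨ RotorSynth (Real.pi / 2) o a := by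
    rintro ⟨q, e⟩
    have he : e = 0 ∨ e = 1 := by omega
    rcases he with rfl | rfl
    · exact h0 q q.2
    · exact step _ _ (h0 q q.2) (hz q)
  by_cases hoa : o = a
  · subst hoa; exact (hall b).resolve_left hab
  by_cases hob : o = b
  · subst hob; exact ((hall a).resolve_left hoa).symm hoa
  · exact (((hall a).resolve_left hoa).symm hoa).trans (Ne.symm hoa) hab
      ((hall b).resolve_left hob)

theorem rotorSynth_pi_div_four {a b : Fin n × Fin 2} (hab : a ≠ b) :
    RotorSynth (Real.pi / 4) a b := by
  have hz : ∀ q : Fin n, RotorSynth (Real.pi / 4) (q, 0) (q, 1) := fun q =>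
    ⟨Tbar q, Subgroup.subset_closure (Or.inl (Or.inl ⟨q, rfl⟩)), coe_Rz q _⟩
  -- A `Tbar` gate pairs `a` with the other Majorana of its site; a π/2 rotor then moves that
  -- partner to `b`.
  have hex : ∃ c, a ≠ c ∧ RotorSynth (Real.pi / 4) a c := by
    obtain ⟨q, e⟩ := a
    have he : e = 0 ∨ e = 1 := by omega
    rcases he with rfl | rfl
    · exact ⟨(q, 1), by simp, hz q⟩
    · exact ⟨(q, 0), by simp, (hz q).symm (by simp)⟩
  obtain ⟨c, hac, hc⟩ := hex
  by_cases hcb : c = b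
  · rwa [← hcb]
  · exact hc.trans hac hab (rotorSynth_pi_div_two hcb)

theorem mul_conjTranspose_eq_one (U : Matrix.unitaryGroup (Fin n → Fin 2) ℂ) :
    (U : QOp n) * (U : QOp n).conjTranspose = 1 := Matrix.mem_unitaryGroup_iff.mp U.2

theorem mul_coe_right_cancel (U : Matrix.unitaryGroup (Fin n → Fin 2) ℂ) {A B : QOp n}
    (h : A * (U : QOp n) = B * (U : QOp n)) : A = B := by
  have := congrArg (· * (U : QOp n).conjTranspose) h
  simpa only [mul_assoc, mul_conjTranspose_eq_one, mul_one] using this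

theorem real_smul_one_injective {c d : ℝ} (h : c • (1 : QOp n) = d • (1 : QOp n)) : c = d := by
  simpa using congrFun (congrFun h 0) 0

/-- The image of `γ_j` still anticommutes with the fixed `γ_b`, and that anticommutator equals `2
v_b`. -/
theorem coeff_eq_zero_of_commute {U : Matrix.unitaryGroup (Fin n → Fin 2) ℂ} {b j : Fin n × Fin 2}
    {v : Fin n × Fin 2 → ℝ} (hv : (U : QOp n) * majorana j = combo majorana v * (U : QOp n))
    (hb : (U : QOp n) * majorana b = majorana b * U) (hbj : b ≠ j) : v b = 0 := by
  have h1 : (majorana b * combo majorana v + combo majorana v * majorana b) * (U : QOp n) =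
      0 * (U : QOp n) := by
    rw [add_mul, mul_assoc, ← hv, ← mul_assoc, ← hb, mul_assoc (combo majorana v), ← hb,
      ← mul_assoc, ← hv, mul_assoc, mul_assoc, ← mul_add, majorana_anticommute hbj]
    simp
  have h2 := mul_coe_right_cancel U h1
  rw [mul_combo_add_combo_mul majorana_mul_self (fun _ _ => majorana_anticommute),
    ← zero_smul ℝ (1 : QOp n)] at h2
  have := real_smul_one_injective h2
  linarith

theorem sum_sq_coeff_eq_one {U : Matrix.unitaryGroup (Fin n → Fin 2) ℂ} {j : Fin n × Fin 2}
    {v : Fin n × Fin 2 → ℝ} (hv : (U : QOp n) * majorana j = combo majorana v * (U : QOp n)) :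
    ∑ x, v x ^ 2 = 1 := by
  have h1 : combo majorana v * combo majorana v * (U : QOp n) = 1 * (U : QOp n) := by
    rw [mul_assoc, ← hv, ← mul_assoc, ← hv, mul_assoc, majorana_mul_self, mul_one, one_mul]
  have h2 := mul_coe_right_cancel U h1
  rw [combo_mul_self majorana_mul_self (fun _ _ => majorana_anticommute),
    ← one_smul ℝ (1 : QOp n), smul_smul, mul_one] at h2
  exact real_smul_one_injective h2

/-- No element of the matchgate group flips the sign of exactly one Majorana operator. -/
theorem not_single_sign_flip {U : Matrix.unitaryGroup (Fin n → Fin 2) ℂ}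
    (hU : U ∈ matchgateGroup n) {j : Fin n × Fin 2}
    (hj : (U : QOp n) * majorana j = -(majorana j * U))
    (h : ∀ b, b ≠ j → (U : QOp n) * majorana b = majorana b * U) : False := by
  have hP := parity_mul_of_mem_matchgateGroup hU
  have hone := mul_conjTranspose_eq_one U
  generalize (U : QOp n) = M at *
  -- Parity flips every Majorana, `γ_j` flips all but `j`, and `M` flips only `j`: the product acts
  -- trivially and is a scalar.
  have h1 : ∀ b, M * majorana j * parity n * majorana b =
      majorana b * (M * majorana j * parity n) := by
    intro b
    rw [mul_assoc, parity_mul_majorana, mul_neg, ← mul_assoc]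
    by_cases hb : b = j
    · subst hb
      rw [← mul_assoc, ← mul_assoc, ← neg_neg (majorana b * M), ← hj, neg_mul, neg_mul]
    · rw [mul_assoc M, ← neg_mul, ← mul_neg, ← majorana_anticommute hb, ← mul_assoc, h b hb]
      simp only [mul_assoc]
  obtain ⟨c, hc⟩ := exists_smul_one_of_commute_majorana _ h1
  -- Since `M` is even and `γ_j` odd, this scalar anticommutes with parity, hence vanishes,
  -- contradicting that `M` and `γ_j` are invertible.
  have h2 : parity n * (M * majorana j * parity n) = -(M * majorana j * parity n * parity n) := by
    rw [← mul_assoc, ← mul_assoc, hP, mul_assoc M, parity_mul_majorana]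
    simp only [mul_assoc, mul_neg, neg_mul]
  have h3 : M * majorana j * parity n * parity n = 0 := by
    have h4 : parity n * (M * majorana j * parity n) = M * majorana j * parity n * parity n := by
      rw [hc]; simp
    ext x y
    exact self_eq_neg.mp (congrFun (congrFun (h4.symm.trans h2) x) y)
  rw [mul_assoc, parity_mul_self, mul_one] at h3
  have h5 : M = 0 := by
    rw [← mul_one M, ← majorana_mul_self j, ← mul_assoc, h3, zero_mul]
  rw [h5, zero_mul] at hone
  exact zero_ne_one hone

/-- Conjugation by the operator maps real `ℤ[1/√2, i]`-combinations of Majorana operators to such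
combinations. -/
def PreservesRing (M : QOp n) : Prop :=
  ∀ v : Fin n × Fin 2 → ℝ, (∀ x, (v x : ℂ) ∈ ringZ) → ∃ w : Fin n × Fin 2 → ℝ,
    (∀ x, (w x : ℂ) ∈ ringZ) ∧ M * combo majorana v = combo majorana w * M

theorem rotor_pi_div_four_mul_combo {a b : Fin n × Fin 2} (hab : a ≠ b)
    (v : Fin n × Fin 2 → ℝ) : rotor majorana a b (Real.pi / 4) * combo majorana v =
      combo majorana (planeRot a b (√2)⁻¹ (√2)⁻¹ v) * rotor majorana a b (Real.pi / 4) := by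
  have h : √2 / 2 = (√2)⁻¹ := by
    rw [div_eq_iff two_ne_zero, eq_inv_mul_iff_mul_eq₀ (by positivity)]
    exact Real.mul_self_sqrt (by norm_num)
  rw [rotor_mul_combo majorana_mul_self (fun _ _ => majorana_anticommute) hab,
    Real.cos_pi_div_four, Real.sin_pi_div_four, h]

theorem preservesRing_rotor {a b : Fin n × Fin 2} (hab : a ≠ b) :
    PreservesRing (rotor majorana a b (Real.pi / 4)) := by
  intro v hv
  refine ⟨_, fun x => ?_, rotor_pi_div_four_mul_combo hab v⟩
  have h : (((√2)⁻¹ : ℝ) : ℂ) ∈ ringZ := by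
    rw [← one_div]; exact Subring.subset_closure (by simp)
  unfold planeRot
  split_ifs
  · rw [Complex.ofReal_add, Complex.ofReal_mul, Complex.ofReal_mul]
    exact add_mem (mul_mem h (hv a)) (mul_mem h (hv b))
  · rw [Complex.ofReal_sub, Complex.ofReal_mul, Complex.ofReal_mul]
    exact sub_mem (mul_mem h (hv b)) (mul_mem h (hv a))
  · exact hv x

theorem PreservesRing.mul {A B : QOp n} (hA : PreservesRing A) (hB : PreservesRing B) :
    PreservesRing (A * B) := by
  intro v hv
  obtain ⟨w, hw, h1⟩ := hB v hv
  obtain ⟨u, hu, h2⟩ := hA w hw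
  exact ⟨u, hu, by rw [mul_assoc, h1, ← mul_assoc, h2, mul_assoc]⟩

/-- A unit vector over `ℤ[1/√2]` is moved to a Majorana operator by the gate set. -/
theorem exists_synth_mul_combo {t : Finset (Fin n × Fin 2)} {j y : Fin n × Fin 2} (hj : j ∈ t)
    (hy : y ∈ t) (hyj : y ≠ j) {v : Fin n × Fin 2 → ℝ} (hv : ∀ x, (v x : ℂ) ∈ ringZ)
    (hs : ∀ x, x ∉ t → v x = 0) (hn : ∑ x, v x ^ 2 = 1) :
    ∃ V ∈ synthGroup n, PreservesRing (V : QOp n) ∧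
      (∀ b, b ∉ t → (V : QOp n) * majorana b = majorana b * (V : QOp n)) ∧
      (V : QOp n) * combo majorana v = majorana j * V := by
  obtain ⟨k, α, β, hk⟩ := exists_int_of_forall_mem_ringZ hv
  -- The predicate also carries ring preservation and commutation outside `t`, so that columns
  -- already reduced stay fixed.
  refine reduce_unit_vector (P := fun v => ∃ V ∈ synthGroup n, PreservesRing (V : QOp n) ∧
      (∀ b, b ∉ t → (V : QOp n) * majorana b = majorana b * (V : QOp n)) ∧
      (V : QOp n) * combo majorana v = majorana j * (V : QOp n)) hj hy hyj ?_ ?_ k _ α β v rfl hk hs hn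
  · rintro a ha b hb hab v ⟨V, hV, hVR, hVt, hVv⟩
    obtain ⟨W, hW, hWr⟩ := rotorSynth_pi_div_four hab
    refine ⟨V * W, mul_mem hV hW, ?_⟩
    have hVW : ((V * W : Matrix.unitaryGroup (Fin n → Fin 2) ℂ) : QOp n) =
      (V : QOp n) * rotor majorana a b (Real.pi / 4) := by rw [← hWr]; rfl
    rw [hVW]
    refine ⟨hVR.mul (preservesRing_rotor hab), fun c hc => ?_, ?_⟩
    · rw [mul_assoc, rotor_mul_of_ne (fun _ _ => majorana_anticommute) (by rintro rfl; exact hc ha)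
        (by rintro rfl; exact hc hb), ← mul_assoc, hVt c hc, mul_assoc]
    · rw [mul_assoc, rotor_pi_div_four_mul_combo hab, ← mul_assoc, hVv, mul_assoc]
  · refine ⟨1, one_mem _, fun v hv => ⟨v, hv, by simp⟩, fun b _ => by simp, ?_⟩
    rw [combo_single]; simp

theorem mem_synthGroup_of_commute_majorana (hn : 0 < n)
    {U : Matrix.unitaryGroup (Fin n → Fin 2) ℂ} (hU : U ∈ matchgateGroup n)
    (h : ∀ b, (U : QOp n) * majorana b = majorana b * (U : QOp n)) : U ∈ synthGroup n := by
  obtain ⟨c, hc⟩ := exists_smul_one_of_commute_majorana _ h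
  rcases eq_one_or_neg_one_of_scalar hU hc with h1 | h1
  · have : U = 1 := Subtype.ext h1
    rw [this]; exact one_mem _
  · have : U = Tbar ⟨0, hn⟩ ^ 8 := by
      apply Subtype.ext
      rw [SubmonoidClass.coe_pow, Tbar, coe_Rz, rotor_pow majorana_mul_self
        (fun _ _ => majorana_anticommute) (by simp), h1, ← rotor_two_pi (γ := majorana)
        ((⟨0, hn⟩, 0) : Fin n × Fin 2) (⟨0, hn⟩, 1)]
      congr 1; push_cast; ring
    rw [this]
    have hT : Tbar ⟨0, hn⟩ ∈ synthGroup n :=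
      Subgroup.subset_closure (Or.inl (Or.inl ⟨_, rfl⟩))
    exact pow_mem hT 8

/-- Column-by-column elimination: `t` holds the Majoranas not yet known to be fixed, and the
induction removes them one at a time. -/
theorem mem_synthGroup_of_commute_outside (hn : 0 < n) (t : Finset (Fin n × Fin 2))
    (U : Matrix.unitaryGroup (Fin n → Fin 2) ℂ) (hU : U ∈ matchgateGroup n)
    (hR : ∀ b, ∃ v : Fin n × Fin 2 → ℝ, (∀ x, (v x : ℂ) ∈ ringZ) ∧
      (U : QOp n) * majorana b = combo majorana v * (U : QOp n))
    (ht : ∀ b, b ∉ t → (U : QOp n) * majorana b = majorana b * U) : U ∈ synthGroup n := by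
  induction t using Finset.induction_on generalizing U with
  | empty => exact mem_synthGroup_of_commute_majorana hn hU fun b => ht b (Finset.notMem_empty b)
  | insert j s hjs ih =>
    obtain ⟨v, hv, hUv⟩ := hR j
    have hsupp : ∀ b, b ∉ insert j s → v b = 0 := fun b hb =>
      coeff_eq_zero_of_commute hUv (ht b hb) (by rintro rfl; simp at hb)
    have hnorm := sum_sq_coeff_eq_one hUv
    rcases s.eq_empty_or_nonempty with rfl | ⟨y, hy⟩
    -- With one Majorana left there is no second coordinate to rotate into; its image is `±γ_j`, and
    -- parity rules out the minus sign.
    · have hsupp' : ∀ b, b ≠ j → v b = 0 := fun b hb => hsupp b (by simpa using hb)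
      have hcombo : combo majorana v = v j • majorana j := by
        unfold combo
        exact Finset.sum_eq_single j (fun b _ hb => by rw [hsupp' b hb, zero_smul]) (by simp)
      rw [Finset.sum_eq_single j (fun b _ hb => by simp [hsupp' b hb]) (by simp)] at hnorm
      have ht' : ∀ b, b ≠ j → (U : QOp n) * majorana b = majorana b * U := fun b hb =>
        ht b (by simpa using hb)
      rcases mul_self_eq_one_iff.mp ((sq _).symm.trans hnorm) with h1 | h1
      · rw [hcombo, h1, one_smul] at hUv
        refine mem_synthGroup_of_commute_majorana hn hU fun b => ?_
        by_cases hb : b = j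
        · rw [hb, hUv]
        · exact ht' b hb
      · rw [hcombo, h1, neg_smul, one_smul, neg_mul] at hUv
        exact (not_single_sign_flip hU hUv ht').elim
    · obtain ⟨V, hV, hVR, hVt, hVv⟩ := exists_synth_mul_combo (Finset.mem_insert_self j s)
        (Finset.mem_insert_of_mem hy) (by rintro rfl; exact hjs hy) hv hsupp hnorm
      have hVU : ((V * U : Matrix.unitaryGroup (Fin n → Fin 2) ℂ) : QOp n) =
        (V : QOp n) * (U : QOp n) := rfl
      -- `V` returns the image of `γ_j` to `γ_j` and commutes with the Majoranas fixed earlier, so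
      -- `V * U` moves only those in `s`.
      have hmem : V * U ∈ synthGroup n := by
        refine ih (V * U) (mul_mem (synthGroup_le_matchgateGroup hV) hU) ?_ ?_
        · intro b
          obtain ⟨w, hw, hUw⟩ := hR b
          obtain ⟨u, hu, hVu⟩ := hVR w hw
          exact ⟨u, hu, by rw [hVU, mul_assoc, hUw, ← mul_assoc, hVu, mul_assoc]⟩
        · intro b hb
          by_cases hbj : b = j
          · rw [hbj, hVU, mul_assoc, hUv, ← mul_assoc, hVv, mul_assoc]
          · have hb' : b ∉ insert j s := by simp [hbj, hb]
            rw [hVU, mul_assoc, ht b hb', ← mul_assoc, hVt b hb', mul_assoc]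
      simpa using mul_mem (inv_mem hV) hmem

end Matchgate

end

theorem theorem3 (n : ℕ) (U : Matrix.unitaryGroup (Fin n → Fin 2) ℂ)
    (hU : U ∈ Matchgate.matchgateGroup n)
    (hring : ∀ a b : (Fin n → Fin 2) × (Fin n → Fin 2),
      Matrix.kronecker (U : Matrix (Fin n → Fin 2) (Fin n → Fin 2) ℂ)
        ((U : Matrix (Fin n → Fin 2) (Fin n → Fin 2) ℂ).map (starRingEnd ℂ)) a b ∈
          Matchgate.ringZ) :
    ∃ L : List (Matrix.unitaryGroup (Fin n → Fin 2) ℂ),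
      (∀ g ∈ L, g ∈ Matchgate.gateSet n) ∧ U = L.prod := by
  -- Without qubits there is no `Tbar` to produce -1, but there are no generators either and the
  -- group is trivial.
  rcases Nat.eq_zero_or_pos n with rfl | hn
  · refine ⟨[], by simp, ?_⟩
    have h : ∀ V ∈ Matchgate.matchgateGroup 0, V = 1 := by
      intro V hV
      have : Matchgate.matchgateGroup 0 ≤ ⊥ := by
        refine (Subgroup.closure_le _).mpr ?_
        rintro W (⟨q, -⟩ | ⟨q, -⟩) <;> exact q.elim0
      exact Subgroup.mem_bot.mp (this hV)
    simpa using h U hU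
  · refine Matchgate.exists_list_of_mem_synthGroup
      (Matchgate.mem_synthGroup_of_commute_outside hn Finset.univ U hU (fun b => ?_) (by simp))
    obtain ⟨v, hv⟩ := Matchgate.exists_combo_of_mem_matchgateGroup hU (Pi.single b 1)
    rw [Matchgate.combo_single] at hv
    exact ⟨v, Matchgate.coeff_mem_ringZ hring hv, hv⟩
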